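/- Let $k$ be a field of characteristic zero. Let $\mathcal H_{CK}$ be the free commutative $k$-algebra on the nonempty (non-planar, finite) rooted trees; its basis consists of the rooted forests, and its unit is the empty forest $\emptyset$. Its (Connes–Kreimer) coproduct is the algebra morphism given on a tree $t$ by $\Delta_{CK}(t)=\sum v\otimes w$, the sum running over the partitions $V\amalg W$ of the vertex set of $t$ with $W<V$ (every $x\in W$ and $y\in V$ that are comparable satisfy $x<y$, the root being the least vertex), where $v,w$ are the forests induced on $V,W$. Let $\mathcal H$ be the free commutative $k$-algebra on the rooted trees with at least one edge; its unit is identified with the one-vertex tree $\bullet$, and its coproduct is the algebra morphism given on a tree by $\Delta(t)=\sum_{s\subseteq t}s\otimes t/s$, where $s$ runs over the subforests of $t$ (the trivial subforest $\bullet$, or a collection of pairwise disjoint subtrees each having at least one edge) and $t/s$ is obtained by contracting each component of $s$ to a vertex. Let $\Phi:\mathcal H_{CK}\to\mathcal H\otimes\mathcal H_{CK}$ and $\Psi:\mathcal H_{CK}\to\mathcal H_{CK}\otimes\mathcal H$ be the algebra morphisms with $\Phi(t)=\Psi(t)=\Delta(t)$ for every nonempty tree $t$, where $\Delta(\bullet)=\bullet\otimes\bullet$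 and where the factor in $\mathcal H_{CK}$ is read as a forest, the trivial subforest (resp. the fully contracted tree) being the tree $\bullet$ of $\mathcal H_{CK}$. For linear forms $\alpha$ on $\mathcal H$ and $b,c$ on $\mathcal H_{CK}$ define the linear forms on $\mathcal H_{CK}$ $$\alpha\star b=(\alpha\otimes b)\circ\Phi,\qquad b\star\alpha=(b\otimes\alpha)\circ\Psi,\qquad b*c=(b\otimes c)\circ\Delta_{CK}.$$ Let $(\delta_s)$ and $(Z_s)$ be the bases dual to the forest bases of $\mathcal H_{CK}$ and $\mathcal H$, and let $\varepsilon=\delta_\emptyset$, the co-unit of $\mathcal H_{CK}$; $Z_\bullet$ corresponds to the unit of $\mathcal H$. Let $\varphi$ be a character of $\mathcal H$ (a unital algebra morphism $\mathcal H\to k$), $\alpha$ a linear form on $\mathcal H$, and $b,c$ linear forms on $\mathcal H_{CK}$. Then: 1. $\alpha\star\varepsilon=\varepsilon\star\alpha=\alpha(\bullet)\,\varepsilon$; 2. $\alpha\star\delta_\bullet=\delta_\bullet\star\alpha=\alpha$, where on the right $\alpha$ stands for the linear form on $\mathcal H_{CK}$ that coincides with $\alpha$ on every nonempty tree and vanishes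 on $\emptyset$ and on the forests with at least two components; 3. $Z_\bullet\star b=b\star Z_\bullet=b$; 4. $\varphi\star(b*c)=(\varphi\star b)*(\varphi\star c)$; 5. if $b$ is invertible for $*$ (with unit $\varepsilon$), then $\varphi\star b$ is invertible for $*$, and its unique inverse is $(\varphi\star b)^{*-1}=\varphi\star b^{*-1}$. -/

import Mathlib

open scoped TensorProduct

noncomputable section

namespace TreeHopf

open scoped Classical

/-- A finite rooted forest, given by its finite set of vertices and by the partial order in which
`x ≤ y` means that the path from a root to `y` passes through `x`. The vertices below a given vertex
form a chain. The edges are the covering pairs of this order; an edge is recorded by its upper end,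
so the edges correspond to the vertices that are not roots. -/
structure Forest where
  verts : Finset ℕ
  le : ℕ → ℕ → Prop
  le_refl : ∀ x ∈ verts, le x x
  le_antisymm : ∀ x ∈ verts, ∀ y ∈ verts, le x y → le y x → x = y
  le_trans : ∀ x ∈ verts, ∀ y ∈ verts, ∀ z ∈ verts, le x y → le y z → le x z
  le_chain : ∀ x ∈ verts, ∀ y ∈ verts, ∀ z ∈ verts, le x z → le y z → le x y ∨ le y x

namespace Forest

/-- The roots are the minimal vertices. -/
def roots (F : Forest) : Finset ℕ :=
  F.verts.filter fun r => ∀ x ∈ F.verts, F.le x r → x = r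

/-- A nonempty rooted tree: one vertex, the root, lies below all the others. -/
def IsTree (F : Forest) : Prop :=
  ∃ r ∈ F.verts, ∀ x ∈ F.verts, F.le r x

/-- Isomorphism of rooted forests (not respecting any planar structure). -/
def Iso (F G : Forest) : Prop :=
  ∃ e : F.verts ≃ G.verts, ∀ x y : F.verts, F.le x y ↔ G.le (e x) (e y)

/-- The forest with vertices in `A` and the induced order. -/
def restrict (F : Forest) (A : Finset ℕ) : Forest where
  verts := F.verts ∩ A
  le := F.le
  le_refl x hx := F.le_refl x (Finset.mem_inter.1 hx).1
  le_antisymm x hx y hy :=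
    F.le_antisymm x (Finset.mem_inter.1 hx).1 y (Finset.mem_inter.1 hy).1
  le_trans x hx y hy z hz :=
    F.le_trans x (Finset.mem_inter.1 hx).1 y (Finset.mem_inter.1 hy).1 z (Finset.mem_inter.1 hz).1
  le_chain x hx y hy z hz :=
    F.le_chain x (Finset.mem_inter.1 hx).1 y (Finset.mem_inter.1 hy).1 z (Finset.mem_inter.1 hz).1

/-- The vertices above `r`; for a root `r`, the connected component of `r`. -/
def above (F : Forest) (r : ℕ) : Forest :=
  F.restrict (F.verts.filter fun x => F.le r x)

theorem above_isTree (F : Forest) {r : ℕ} (hr : r ∈ F.roots) : (F.above r).IsTree := by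
  have h : r ∈ F.verts := (Finset.mem_filter.1 hr).1
  refine ⟨r, ?_, fun x hx => ?_⟩
  · simp [above, restrict, h, F.le_refl r h]
  · simp only [above, restrict, Finset.mem_inter, Finset.mem_filter] at hx
    exact hx.2.2

/-- The edges of `F`, recorded by their upper ends. -/
def edges (F : Forest) : Finset ℕ := F.verts \ F.roots

/-- The spanning subforest of `F` with set of edges `S`: now `x ≤ y` if all the edges on the path
from `x` up to `y` belong to `S`. -/
def spanning (F : Forest) (S : Finset ℕ) : Forest where
  verts := F.verts
  le x y := F.le x y ∧ ∀ z ∈ F.verts, F.le x z → z ≠ x → F.le z y → z ∈ S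
  le_refl x hx :=
    ⟨F.le_refl x hx, fun z hz h1 h2 h3 => absurd (F.le_antisymm z hz x hx h3 h1) h2⟩
  le_antisymm x hx y hy h1 h2 := F.le_antisymm x hx y hy h1.1 h2.1
  le_trans x hx y hy z hz h1 h2 := by
    refine ⟨F.le_trans x hx y hy z hz h1.1 h2.1, fun w hw hxw hne hwz => ?_⟩
    rcases F.le_chain w hw y hy z hz hwz h2.1 with h | h
    · exact h1.2 w hw hxw hne h
    · by_cases hwy : w = y
      · exact h1.2 w hw hxw hne (hwy ▸ F.le_refl w hw)
      · exact h2.2 w hw h hwy hwz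
  le_chain x hx y hy z hz h1 h2 := by
    rcases F.le_chain x hx y hy z hz h1.1 h2.1 with h | h
    · exact Or.inl ⟨h, fun w hw hxw hne hwy =>
        h1.2 w hw hxw hne (F.le_trans w hw y hy z hz hwy h2.1)⟩
    · exact Or.inr ⟨h, fun w hw hxw hne hwy =>
        h2.2 w hw hxw hne (F.le_trans w hw x hx z hz hwy h1.1)⟩

/-- The forest obtained from `F` by contracting all the edges in `S`. The vertex onto which a
component of the spanning subforest is contracted is represented by the lowest vertex of that
component, and these are the vertices that are not the upper end of an edge in `S`. The path from a
root to the component of `y` meets the component of `x` if and only if it passes through the lowest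
vertex of the latter, so the order is the induced one. -/
def contract (F : Forest) (S : Finset ℕ) : Forest := F.restrict (F.verts \ S)

/-- The sets `V` of vertices such that, with `W` the complementary set, `W < V`: whenever `x ∈ W`
and `y ∈ V` are comparable, `x < y`. Both `V` and `W` are then convex, so the induced order on each
of them is the one given by the edges that link two of its elements. -/
def crowns (F : Forest) : Finset (Finset ℕ) :=
  F.verts.powerset.filter fun V =>
    ∀ x ∈ F.verts \ V, ∀ y ∈ V, (F.le x y ∨ F.le y x) → (F.le x y ∧ x ≠ y)

/-- The forest with a single vertex. -/
def point : Forest where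
  verts := {0}
  le x y := x = y
  le_refl _ _ := rfl
  le_antisymm _ _ _ _ h _ := h
  le_trans _ _ _ _ _ _ h h' := h.trans h'
  le_chain _ _ _ _ _ _ h h' := Or.inl (h.trans h'.symm)

end Forest

/-- Isomorphism of nonempty rooted trees. -/
instance treeSetoid : Setoid {F : Forest // F.IsTree} where
  r F G := F.1.Iso G.1
  iseqv :=
    { refl := fun _ => ⟨Equiv.refl _, fun _ _ => Iff.rfl⟩
      symm := fun ⟨e, he⟩ => ⟨e.symm, fun x y => by simp [he]⟩
      trans := fun ⟨e, he⟩ ⟨f, hf⟩ => ⟨e.trans f, fun x y => by simp [he, hf]⟩ }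

/-- Nonempty (non-planar) rooted trees, i.e. isomorphism classes. -/
def RTree : Type := Quotient treeSetoid

namespace RTree

/-- A representative of the isomorphism class `t`. -/
def rep (t : RTree) : Forest := (Quotient.out t).1

/-- The tree `•` with one vertex. -/
def dot : RTree := Quotient.mk treeSetoid ⟨Forest.point, 0, by simp [Forest.point], by
  intro x hx; simpa [Forest.point, eq_comm] using hx⟩

end RTree

/-- The connected component of the root `r` of a forest. -/
def Forest.component (F : Forest) (r : F.roots) : RTree :=
  Quotient.mk treeSetoid ⟨F.above r, F.above_isTree r.2⟩

variable (k : Type*) [Field k]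

/-- The Connes–Kreimer algebra: the free commutative algebra on the nonempty rooted trees. -/
abbrev HCK : Type _ := MvPolynomial RTree k

/-- The algebra `H`: the free commutative algebra on the rooted trees with at least one edge, i.e.
on the nonempty rooted trees other than `•`. -/
abbrev H : Type _ := MvPolynomial {t : RTree // t ≠ RTree.dot} k

/-- A rooted forest as an element of `HCK`: the product of its components. -/
def Forest.toHCK (F : Forest) : HCK k :=
  ∏ r : F.roots, MvPolynomial.X (F.component r)

/-- A nonempty rooted tree as an element of `H`, where `•` is identified with the unit. -/
def RTree.toH (t : RTree) : H k :=
  if h : t = RTree.dot then 1 else MvPolynomial.X ⟨t, h⟩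

/-- A rooted forest as an element of `H`: the product of its components, where `•` is identified
with the unit. -/
def Forest.toH (F : Forest) : H k :=
  ∏ r : F.roots, (F.component r).toH k

/-- The coproduct of `H`, the algebra morphism with `Δ(t) = ∑ s ⊗ t/s`, the sum over all the
subforests `s` of the tree `t`. A subforest, a collection of disjoint subtrees each having at least
one edge, is determined by its set of edges, which can be any set of edges of `t` (the empty set
gives the trivial subforest `•`, the unit). -/
def coproduct : H k →ₐ[k] H k ⊗[k] H k :=
  MvPolynomial.aeval fun t =>
    ∑ S ∈ t.1.rep.edges.powerset,
      (t.1.rep.spanning S).toH k ⊗ₜ[k] (t.1.rep.contract S).toH k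

/-- The coproduct of the Connes–Kreimer algebra, the algebra morphism with `Δ(t) = ∑ v ⊗ w`, the sum
over all the partitions of the vertices of `t` into `V` (crown) and `W` (trunk) with `W < V`. -/
def coproductCK : HCK k →ₐ[k] HCK k ⊗[k] HCK k :=
  MvPolynomial.aeval fun t =>
    ∑ V ∈ t.rep.crowns,
      (t.rep.restrict V).toHCK k ⊗ₜ[k] (t.rep.restrict (t.rep.verts \ V)).toHCK k

/-- The linear embedding of `H` into `HCK` which sends the unit of `H` to the tree `•`, and each
other forest without one-vertex components to itself. -/
def incl : H k →ₗ[k] HCK k :=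
  (MvPolynomial.basisMonomials _ k).constr k fun m =>
    if m = 0 then MvPolynomial.X RTree.dot
    else MvPolynomial.rename Subtype.val (MvPolynomial.monomial m (1 : k))

/-- The left coaction: the algebra morphism `HCK → H ⊗ HCK` with `Φ(t) = Δ(t)` for each nonempty
tree `t`. -/
def Phi : HCK k →ₐ[k] H k ⊗[k] HCK k :=
  MvPolynomial.aeval fun t => (incl k).lTensor (H k) (coproduct k (t.toH k))

/-- The right coaction: the algebra morphism `HCK → HCK ⊗ H` with `Ψ(t) = Δ(t)` for each nonempty
tree `t`. -/
def Psi : HCK k →ₐ[k] HCK k ⊗[k] H k :=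
  MvPolynomial.aeval fun t => (incl k).rTensor (H k) (coproduct k (t.toH k))

variable {k}

/-- `α ⋆ b = m ∘ (α ⊗ b) ∘ Φ`. -/
def actL (α : H k →ₗ[k] k) (b : HCK k →ₗ[k] k) : HCK k →ₗ[k] k :=
  LinearMap.mul' k k ∘ₗ TensorProduct.map α b ∘ₗ (Phi k).toLinearMap

/-- `b ⋆ α = m ∘ (b ⊗ α) ∘ Ψ`. -/
def actR (b : HCK k →ₗ[k] k) (α : H k →ₗ[k] k) : HCK k →ₗ[k] k :=
  LinearMap.mul' k k ∘ₗ TensorProduct.map b α ∘ₗ (Psi k).toLinearMap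

/-- The convolution product `b * c = m ∘ (b ⊗ c) ∘ Δ_CK`. -/
def conv (b c : HCK k →ₗ[k] k) : HCK k →ₗ[k] k :=
  LinearMap.mul' k k ∘ₗ TensorProduct.map b c ∘ₗ (coproductCK k).toLinearMap

variable (k)

/-- The element `δ_s` of the basis dual to the forest basis of `HCK`; a forest is given by the
multiplicities of its components. -/
def delta (s : RTree →₀ ℕ) : HCK k →ₗ[k] k := MvPolynomial.lcoeff k s

/-- The element `Z_s` of the basis dual to the forest basis of `H`. -/
def Z (s : {t : RTree // t ≠ RTree.dot} →₀ ℕ) : H k →ₗ[k] k := MvPolynomial.lcoeff k s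

/-- The co-unit `ε = δ_∅` of the Connes–Kreimer algebra. -/
def counitCK : HCK k →ₗ[k] k := delta k 0

/-- `δ_•`. -/
def deltaDot : HCK k →ₗ[k] k := delta k (Finsupp.single RTree.dot 1)

/-- `Z_•`, where `•` is the unit (empty product) of `H`. -/
def ZDot : H k →ₗ[k] k := Z k 0

variable {k}

/-- A linear form on `H` seen as a linear form on `HCK`: the one with the same value on each nonempty
tree, and zero on the empty forest and on the forests with two or more components. -/
def onTrees (α : H k →ₗ[k] k) : HCK k →ₗ[k] k :=
  (MvPolynomial.basisMonomials RTree k).constr k fun m =>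
    ∑ t ∈ m.support, if m = Finsupp.single t 1 then α (t.toH k) else 0

/-- `b'` is a two-sided inverse of `b` for the convolution product. -/
def IsConvInverse (b b' : HCK k →ₗ[k] k) : Prop :=
  conv b b' = counitCK k ∧ conv b' b = counitCK k

end TreeHopf

end

open TreeHopf

/-! The form `φ ⋆ b` is the composite of `b` with the algebra endomorphism `(φ ⊗ id) ∘ Φ` of
`HCK`, so it is enough that this endomorphism respects the Connes–Kreimer coproduct and its co-unit.
For the coproduct this is a bijection: to contract a set `S` of edges of a forest and then to cut
off a crown is the same as to cut off a crown `V` such that no edge of `S` is cut, and then to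
contract the two parts of `S` in the two pieces; moreover `φ`, being a character, takes the forest
spanned by `S` to the product of its values on these two parts. Formulas known on trees hold on all
forests, because crowns and sets of edges are chosen independently in the connected components.

The identities involving `ε`, `δ_•` and `Z_•` only depend on the co-unit laws of the coproduct of
`H`. These hold for the opposite coproduct too, so that the left and right actions are treated at
once. As `δ_•` is a derivation over the augmentation, `α ⋆ δ_•` is determined by its values on
trees. -/

noncomputable section

namespace TreeHopf

open scoped Classical

theorem sum_powerset_union_of_disjoint {ι M : Type*} [DecidableEq ι] [AddCommMonoid M]
    {A B : Finset ι} (h : Disjoint A B) (g : Finset ι → M) :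
    ∑ S ∈ (A ∪ B).powerset, g S = ∑ S ∈ A.powerset, ∑ T ∈ B.powerset, g (S ∪ T) := by
  rw [← Finset.sum_product']
  have hunion : ∀ S ∈ (A ∪ B).powerset, S ∩ A ∪ S ∩ B = S := fun S hS => by
    rw [← Finset.inter_union_distrib_left, Finset.inter_eq_left.2 (Finset.mem_powerset.1 hS)]
  refine Finset.sum_nbij' (fun S => (S ∩ A, S ∩ B)) (fun p => p.1 ∪ p.2) (fun S _ => ?_)
    (fun p hp => ?_) hunion (fun p hp => ?_) (fun S hS => (congrArg g (hunion S hS)).symm)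
  · exact Finset.mem_product.2 ⟨Finset.mem_powerset.2 Finset.inter_subset_right,
      Finset.mem_powerset.2 Finset.inter_subset_right⟩
  all_goals
    obtain ⟨hA, hB⟩ := Finset.mem_product.1 hp
    rw [Finset.mem_powerset] at hA hB
  · exact Finset.mem_powerset.2 (Finset.union_subset_union hA hB)
  · have hBA : Disjoint p.2 A := Finset.disjoint_of_subset_left hB h.symm
    have hAB : Disjoint p.1 B := Finset.disjoint_of_subset_left hA h
    refine Prod.ext_iff.2 ⟨?_, ?_⟩
    · rw [Finset.union_inter_distrib_right, Finset.inter_eq_left.2 hA,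
        Finset.disjoint_iff_inter_eq_empty.1 hBA, Finset.union_empty]
    · dsimp only
      rw [Finset.union_inter_distrib_right, Finset.inter_eq_left.2 hB,
        Finset.disjoint_iff_inter_eq_empty.1 hAB, Finset.empty_union]

namespace Forest

theorem ext_of_verts_le {F G : Forest} (hv : F.verts = G.verts) (hl : F.le = G.le) : F = G := by
  cases F; cases G; cases hv; cases hl; rfl

@[simp] theorem restrict_verts (F : Forest) (A : Finset ℕ) :
    (F.restrict A).verts = F.verts ∩ A := rfl

@[simp] theorem contract_verts (F : Forest) (S : Finset ℕ) :
    (F.contract S).verts = F.verts \ S :=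
  Finset.inter_eq_right.2 Finset.sdiff_subset

theorem restrict_congr (F : Forest) {A B : Finset ℕ} (h : F.verts ∩ A = F.verts ∩ B) :
    F.restrict A = F.restrict B :=
  ext_of_verts_le h rfl

theorem restrict_restrict (F : Forest) (A B : Finset ℕ) :
    (F.restrict A).restrict B = F.restrict (A ∩ B) :=
  ext_of_verts_le (Finset.inter_assoc _ _ _) rfl

theorem mem_roots {F : Forest} {r : ℕ} :
    r ∈ F.roots ↔ r ∈ F.verts ∧ ∀ x ∈ F.verts, F.le x r → x = r :=
  Finset.mem_filter

theorem mem_edges {F : Forest} {x : ℕ} :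
    x ∈ F.edges ↔ x ∈ F.verts ∧ ∃ y ∈ F.verts, F.le y x ∧ y ≠ x := by
  simp only [edges, Finset.mem_sdiff, mem_roots, not_and, not_forall, exists_prop]
  exact and_congr_right fun hx => ⟨fun h => h hx, fun h _ => h⟩

theorem roots_subset_verts (F : Forest) : F.roots ⊆ F.verts := Finset.filter_subset _ _

theorem edges_subset_verts (F : Forest) : F.edges ⊆ F.verts := Finset.sdiff_subset

/-- The number of vertices below or equal to `x`, by which roots and parents are found. -/
def height (F : Forest) (x : ℕ) : ℕ := (F.verts.filter fun y => F.le y x).card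

theorem height_lt_height (F : Forest) {x y : ℕ} (hx : x ∈ F.verts) (hy : y ∈ F.verts)
    (hxy : F.le x y) (hne : x ≠ y) : F.height x < F.height y := by
  refine Finset.card_lt_card ((Finset.ssubset_iff_of_subset fun z hz => ?_).2 ⟨y, ?_, ?_⟩)
  · rw [Finset.mem_filter] at hz ⊢
    exact ⟨hz.1, F.le_trans z hz.1 x hx y hy hz.2 hxy⟩
  · exact Finset.mem_filter.2 ⟨hy, F.le_refl y hy⟩
  · exact fun h => hne (F.le_antisymm x hx y hy hxy (Finset.mem_filter.1 h).2)

theorem exists_root_le (F : Forest) {x : ℕ} (hx : x ∈ F.verts) : ∃ r ∈ F.roots, F.le r x := by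
  obtain ⟨r, hr, hmin⟩ := Finset.exists_min_image (F.verts.filter fun y => F.le y x) F.height
    ⟨x, Finset.mem_filter.2 ⟨hx, F.le_refl x hx⟩⟩
  simp only [Finset.mem_filter, and_imp] at hr hmin
  refine ⟨r, mem_roots.2 ⟨hr.1, fun y hy hyr => ?_⟩, hr.2⟩
  by_contra hne
  exact (F.height_lt_height hy hr.1 hyr hne).not_ge
    (hmin y hy (F.le_trans y hy r hr.1 x hx hyr hr.2))

theorem exists_parent (F : Forest) {x : ℕ} (hx : x ∈ F.edges) :
    ∃ p ∈ F.verts, F.le p x ∧ p ≠ x ∧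
      ∀ z ∈ F.verts, F.le p z → z ≠ p → F.le z x → z = x := by
  obtain ⟨-, y, hy, hyx, hne⟩ := mem_edges.1 hx
  obtain ⟨p, hp, hmax⟩ := Finset.exists_max_image
    (F.verts.filter fun y => F.le y x ∧ y ≠ x) F.height ⟨y, Finset.mem_filter.2 ⟨hy, hyx, hne⟩⟩
  simp only [Finset.mem_filter, and_imp] at hp hmax
  refine ⟨p, hp.1, hp.2.1, hp.2.2, fun z hz hpz hzp hzx => ?_⟩
  by_contra hne
  exact (F.height_lt_height hp.1 hz hpz hzp.symm).not_ge (hmax z hz hzx hne)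

/-- The map `f` on vertices is an isomorphism from `F` to `G`. A map on all of `ℕ` is easier to
carry through restrictions than an equivalence between sets of vertices. -/
structure IsoVia (f : ℕ → ℕ) (F G : Forest) : Prop where
  injOn : Set.InjOn f F.verts
  image_verts : F.verts.image f = G.verts
  le_iff : ∀ x ∈ F.verts, ∀ y ∈ F.verts, (F.le x y ↔ G.le (f x) (f y))

theorem Iso.exists_isoVia {F G : Forest} (h : F.Iso G) : ∃ f, IsoVia f F G := by
  obtain ⟨e, he⟩ := h
  let f : ℕ → ℕ := fun x => if hx : x ∈ F.verts then e ⟨x, hx⟩ else 0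
  have hf : ∀ x (hx : x ∈ F.verts), f x = e ⟨x, hx⟩ := fun x hx => dif_pos hx
  refine ⟨f, fun x hx y hy hxy => ?_, ?_, fun x hx y hy => ?_⟩
  · rw [hf x hx, hf y hy] at hxy
    exact congrArg Subtype.val (e.injective (Subtype.ext hxy))
  · ext y
    refine Finset.mem_image.trans ⟨?_, fun hy => ?_⟩
    · rintro ⟨x, hx, rfl⟩
      exact hf x hx ▸ (e ⟨x, hx⟩).2
    · exact ⟨e.symm ⟨y, hy⟩, (e.symm _).2, by rw [hf _ (e.symm _).2, Subtype.coe_eta,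
        Equiv.apply_symm_apply]⟩
  · rw [hf x hx, hf y hy]
    exact he ⟨x, hx⟩ ⟨y, hy⟩

theorem Iso.refl (F : Forest) : F.Iso F := ⟨Equiv.refl _, fun _ _ => Iff.rfl⟩

theorem isoVia_id {F G : Forest} (hv : F.verts = G.verts)
    (hl : ∀ x ∈ F.verts, ∀ y ∈ F.verts, (F.le x y ↔ G.le x y)) : IsoVia id F G :=
  ⟨Set.injOn_id _, Finset.image_id.trans hv, hl⟩

namespace IsoVia

variable {f : ℕ → ℕ} {F G : Forest} (h : IsoVia f F G) {A : Finset ℕ} {x : ℕ}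
include h

theorem apply_mem (hx : x ∈ F.verts) : f x ∈ G.verts :=
  h.image_verts ▸ Finset.mem_image_of_mem f hx

theorem exists_apply_eq {y : ℕ} (hy : y ∈ G.verts) : ∃ x ∈ F.verts, f x = y :=
  Finset.mem_image.1 (h.image_verts ▸ hy)

theorem iso : F.Iso G := by
  refine ⟨Equiv.ofBijective (fun x : F.verts => ⟨f x, h.apply_mem x.2⟩)
    ⟨fun x y hxy => ?_, fun y => ?_⟩, fun x y => h.le_iff x x.2 y y.2⟩
  · exact Subtype.ext (h.injOn x.2 y.2 (congrArg Subtype.val hxy))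
  · obtain ⟨x, hx, hxy⟩ := h.exists_apply_eq y.2
    exact ⟨⟨x, hx⟩, Subtype.ext hxy⟩

theorem apply_mem_image_iff (hA : A ⊆ F.verts) (hx : x ∈ F.verts) : f x ∈ A.image f ↔ x ∈ A := by
  refine ⟨fun hfx => ?_, Finset.mem_image_of_mem f⟩
  obtain ⟨y, hy, hyx⟩ := Finset.mem_image.1 hfx
  exact h.injOn (hA hy) hx hyx ▸ hy

theorem image_injOn : Set.InjOn (Finset.image f) {A | A ⊆ F.verts} := by
  intro A hA B hB hAB
  ext x
  by_cases hx : x ∈ F.verts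
  · rw [← h.apply_mem_image_iff hA hx, ← h.apply_mem_image_iff hB hx, hAB]
  · exact iff_of_false (fun hxA => hx (hA hxA)) (fun hxB => hx (hB hxB))

theorem image_subset_verts (hA : A ⊆ F.verts) : A.image f ⊆ G.verts :=
  h.image_verts ▸ Finset.image_subset_image hA

theorem exists_image_eq {B : Finset ℕ} (hB : B ⊆ G.verts) : ∃ A ⊆ F.verts, A.image f = B :=
  Finset.subset_image_iff.1 (h.image_verts ▸ hB)

theorem image_sdiff (hA : A ⊆ F.verts) : (F.verts \ A).image f = G.verts \ A.image f :=
  h.image_verts ▸ Finset.image_sdiff_of_injOn h.injOn hA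

theorem restrict (hA : A ⊆ F.verts) : IsoVia f (F.restrict A) (G.restrict (A.image f)) where
  injOn := h.injOn.mono (Finset.coe_subset.2 Finset.inter_subset_left)
  image_verts := by
    rw [restrict_verts, restrict_verts, Finset.inter_eq_right.2 hA,
      Finset.inter_eq_right.2 (h.image_subset_verts hA)]
  le_iff x hx y hy := h.le_iff x (Finset.mem_inter.1 hx).1 y (Finset.mem_inter.1 hy).1

theorem contract (hA : A ⊆ F.verts) : IsoVia f (F.contract A) (G.contract (A.image f)) := by
  rw [Forest.contract, Forest.contract, ← h.image_sdiff hA]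
  exact h.restrict Finset.sdiff_subset

theorem spanning (hA : A ⊆ F.verts) : IsoVia f (F.spanning A) (G.spanning (A.image f)) where
  injOn := h.injOn
  image_verts := h.image_verts
  le_iff x hx y hy := by
    refine and_congr (h.le_iff x hx y hy)
      ⟨fun H w hw hxw hne hwy => ?_, fun H z hz hxz hne hzy => ?_⟩
    · obtain ⟨z, hz, rfl⟩ := h.exists_apply_eq hw
      exact (h.apply_mem_image_iff hA hz).2 (H z hz ((h.le_iff x hx z hz).2 hxw)
        (fun hzx => hne (hzx ▸ rfl)) ((h.le_iff z hz y hy).2 hwy))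
    · exact (h.apply_mem_image_iff hA hz).1 (H (f z) (h.apply_mem hz) ((h.le_iff x hx z hz).1 hxz)
        (fun hzx => hne (h.injOn hz hx hzx)) ((h.le_iff z hz y hy).1 hzy))

theorem apply_mem_roots_iff (hx : x ∈ F.verts) : f x ∈ G.roots ↔ x ∈ F.roots := by
  simp only [mem_roots, hx, h.apply_mem hx, true_and]
  refine ⟨fun H y hy hyx => h.injOn hy hx (H _ (h.apply_mem hy) ((h.le_iff y hy x hx).1 hyx)),
    fun H w hw hwx => ?_⟩
  obtain ⟨y, hy, rfl⟩ := h.exists_apply_eq hw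
  rw [H y hy ((h.le_iff y hy x hx).2 hwx)]

theorem image_roots : F.roots.image f = G.roots := by
  ext y
  refine Finset.mem_image.trans ⟨?_, fun hy => ?_⟩
  · rintro ⟨x, hx, rfl⟩
    exact (h.apply_mem_roots_iff (F.roots_subset_verts hx)).2 hx
  · obtain ⟨x, hx, rfl⟩ := h.exists_apply_eq (G.roots_subset_verts hy)
    exact ⟨x, (h.apply_mem_roots_iff hx).1 hy, rfl⟩

theorem image_edges : F.edges.image f = G.edges := by
  rw [edges, edges, h.image_sdiff F.roots_subset_verts, h.image_roots]

theorem above (hx : x ∈ F.verts) : IsoVia f (F.above x) (G.above (f x)) := by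
  have himage : (F.verts.filter fun y => F.le x y).image f =
      G.verts.filter fun z => G.le (f x) z := by
    rw [← h.image_verts, Finset.filter_image]
    exact congrArg _ (Finset.filter_congr fun y hy => h.le_iff x hx y hy)
  rw [Forest.above, Forest.above, ← himage]
  exact h.restrict (Finset.filter_subset _ _)

end IsoVia

/-- A set of vertices closed upwards: the crowns are described in terms of comparable pairs, and are
exactly these sets. -/
def IsUpper (F : Forest) (V : Finset ℕ) : Prop :=
  V ⊆ F.verts ∧ ∀ x ∈ V, ∀ y ∈ F.verts, F.le x y → y ∈ V

theorem mem_crowns {F : Forest} {V : Finset ℕ} : V ∈ F.crowns ↔ F.IsUpper V := by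
  rw [crowns, Finset.mem_filter, Finset.mem_powerset, IsUpper]
  refine and_congr_right fun hV => ⟨fun H x hx y hy hxy => ?_, fun H x hx y hy hxy => ?_⟩
  · by_contra hyV
    obtain ⟨hyx, hne⟩ := H y (Finset.mem_sdiff.2 ⟨hy, hyV⟩) x hx (Or.inr hxy)
    exact hne (F.le_antisymm y hy x (hV hx) hyx hxy)
  · obtain ⟨hxF, hxV⟩ := Finset.mem_sdiff.1 hx
    have hxy := hxy.resolve_right fun hyx => hxV (H y hy x hxF hyx)
    exact ⟨hxy, fun he => hxV (he ▸ hy)⟩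

theorem IsoVia.isUpper_image_iff {f : ℕ → ℕ} {F G : Forest} (h : IsoVia f F G) {V : Finset ℕ}
    (hV : V ⊆ F.verts) : G.IsUpper (V.image f) ↔ F.IsUpper V := by
  refine and_congr (iff_of_true (h.image_subset_verts hV) hV)
    ⟨fun H x hx y hy hxy => ?_, fun H w hw z hz hwz => ?_⟩
  · exact (h.apply_mem_image_iff hV hy).1 (H _ (Finset.mem_image_of_mem f hx) _ (h.apply_mem hy)
      ((h.le_iff x (hV hx) y hy).1 hxy))
  · obtain ⟨x, hx, rfl⟩ := Finset.mem_image.1 hw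
    obtain ⟨y, hy, rfl⟩ := h.exists_apply_eq hz
    exact Finset.mem_image_of_mem f (H x hx y hy ((h.le_iff x (hV hx) y hy).2 hwz))

/-- A union of connected components. The set need not consist of vertices only. -/
def IsSaturated (F : Forest) (A : Finset ℕ) : Prop :=
  ∀ x ∈ F.verts, ∀ y ∈ F.verts, F.le x y → (x ∈ A ↔ y ∈ A)

theorem IsSaturated.verts_sdiff {F : Forest} {A : Finset ℕ} (hA : F.IsSaturated A) :
    F.IsSaturated (F.verts \ A) := fun x hx y hy hxy => by
  simp only [Finset.mem_sdiff, hx, hy, true_and, hA x hx y hy hxy]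

theorem roots_restrict {F : Forest} {A : Finset ℕ} (hA : F.IsSaturated A) :
    (F.restrict A).roots = F.roots ∩ A := by
  ext r
  simp only [mem_roots, restrict_verts, Finset.mem_inter]
  refine ⟨fun ⟨⟨hr, hrA⟩, H⟩ => ⟨⟨hr, fun x hx hxr => ?_⟩, hrA⟩,
    fun ⟨⟨hr, H⟩, hrA⟩ => ⟨⟨hr, hrA⟩, fun x hx => H x hx.1⟩⟩
  exact H x ⟨hx, (hA x hx r hr hxr).2 hrA⟩ hxr

theorem edges_restrict {F : Forest} {A : Finset ℕ} (hA : F.IsSaturated A) :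
    (F.restrict A).edges = F.edges ∩ A := by
  rw [edges, edges, roots_restrict hA, restrict_verts]
  exact (inf_sdiff_distrib_right F.verts F.roots A).symm

theorem above_restrict {F : Forest} {A : Finset ℕ} (hA : F.IsSaturated A) {r : ℕ}
    (hr : r ∈ F.verts) (hrA : r ∈ A) : (F.restrict A).above r = F.above r := by
  rw [above, restrict_restrict]
  refine F.restrict_congr (Finset.ext fun x => ?_)
  simp only [restrict_verts, Finset.mem_inter, Finset.mem_filter]
  refine and_congr_right fun hx => ⟨fun h => ⟨hx, h.2.2⟩, fun h => ?_⟩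
  have hxA := (hA r hr x hx h.2).1 hrA
  exact ⟨hxA, ⟨hx, hxA⟩, h.2⟩

theorem isSaturated_above {F : Forest} {r : ℕ} (hr : r ∈ F.roots) :
    F.IsSaturated (F.verts.filter fun x => F.le r x) := by
  obtain ⟨hrF, hmin⟩ := mem_roots.1 hr
  intro x hx y hy hxy
  simp only [Finset.mem_filter, hx, hy, true_and]
  refine ⟨fun h => F.le_trans r hrF x hx y hy h hxy, fun hry => ?_⟩
  rcases F.le_chain r hrF x hx y hy hry hxy with h | h
  · exact h
  · exact hmin x hx h ▸ F.le_refl x hx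

end Forest

namespace RTree

/-- The isomorphism class of a tree, as a term of `RTree`. -/
def mk {F : Forest} (h : F.IsTree) : RTree := Quotient.mk treeSetoid ⟨F, h⟩

theorem mk_eq_mk {F G : Forest} {hF : F.IsTree} {hG : G.IsTree} (h : F.Iso G) : mk hF = mk hG :=
  Quotient.sound h

theorem isTree_rep (t : RTree) : t.rep.IsTree := (Quotient.out t).2

theorem mk_rep (t : RTree) : mk t.isTree_rep = t := Quotient.out_eq t

theorem rep_mk_iso {F : Forest} (h : F.IsTree) : (mk h).rep.Iso F :=
  Quotient.mk_out (s := treeSetoid) ⟨F, h⟩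

end RTree

namespace Forest

theorem roots_eq_singleton {F : Forest} {r : ℕ} (hr : r ∈ F.verts) (h : ∀ x ∈ F.verts, F.le r x) :
    F.roots = {r} := by
  ext x
  rw [Finset.mem_singleton, mem_roots]
  refine ⟨fun hx => (hx.2 r hr (h x hx.1)).symm, ?_⟩
  rintro rfl
  exact ⟨hr, fun y hy hyx => F.le_antisymm y hy x hr hyx (h y hy)⟩

/-- The component of the root `r`, with the junk value `•` when `r` is not a root. -/
def componentAt (F : Forest) (r : ℕ) : RTree :=
  if h : r ∈ F.roots then F.component ⟨r, h⟩ else RTree.dot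

theorem componentAt_eq_of_iso {F G : Forest} {r s : ℕ} (hr : r ∈ F.roots) (hs : s ∈ G.roots)
    (h : (F.above r).Iso (G.above s)) : F.componentAt r = G.componentAt s := by
  rw [componentAt, componentAt, dif_pos hr, dif_pos hs]
  exact RTree.mk_eq_mk h

theorem componentAt_restrict {F : Forest} {A : Finset ℕ} (hA : F.IsSaturated A) {r : ℕ}
    (hr : r ∈ F.roots ∩ A) : (F.restrict A).componentAt r = F.componentAt r := by
  have hr' := hr
  rw [Finset.mem_inter] at hr'
  refine componentAt_eq_of_iso ((roots_restrict hA).symm ▸ hr) hr'.1 ?_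
  rw [above_restrict hA (F.roots_subset_verts hr'.1) hr'.2]
  exact Iso.refl _

theorem prod_component {M : Type*} [CommMonoid M] (F : Forest) (g : RTree → M) :
    ∏ r : F.roots, g (F.component r) = ∏ r ∈ F.roots, g (F.componentAt r) := by
  rw [← Finset.prod_coe_sort F.roots fun r => g (F.componentAt r)]
  exact Finset.prod_congr rfl fun r _ => by rw [componentAt, dif_pos r.2]

theorem prod_component_of_isTree {M : Type*} [CommMonoid M] {F : Forest} (h : F.IsTree)
    (g : RTree → M) : ∏ r : F.roots, g (F.component r) = g (RTree.mk h) := by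
  obtain ⟨r, hr, hle⟩ := id h
  have hroots := roots_eq_singleton hr hle
  have hrF : r ∈ F.roots := hroots ▸ Finset.mem_singleton_self r
  have habove : F.above r = F := ext_of_verts_le (by
    rw [above, Finset.filter_true_of_mem hle, restrict_verts, Finset.inter_self]) rfl
  rw [prod_component, hroots, Finset.prod_singleton, componentAt, dif_pos hrF]
  exact congrArg g (RTree.mk_eq_mk (by
    rw [habove]
    exact Iso.refl F))

/-- A function on forests, with values in a commutative monoid, which only depends on the
isomorphism class and turns disjoint unions into products. -/
structure IsMultiplicative {M : Type*} [CommMonoid M] (Q : Forest → M) : Prop where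
  map_iso : ∀ {F G : Forest}, F.Iso G → Q F = Q G
  map_empty : ∀ {F : Forest}, F.verts = ∅ → Q F = 1
  map_mul : ∀ {F : Forest} {A : Finset ℕ}, F.IsSaturated A →
    Q F = Q (F.restrict A) * Q (F.restrict (F.verts \ A))

namespace IsMultiplicative

theorem comp {M N : Type*} [CommMonoid M] [CommMonoid N] {Q : Forest → M}
    (hQ : IsMultiplicative Q) (g : M →* N) : IsMultiplicative fun F => g (Q F) where
  map_iso h := congrArg g (hQ.map_iso h)
  map_empty h := by rw [hQ.map_empty h, map_one]
  map_mul h := by rw [hQ.map_mul h, _root_.map_mul]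

theorem ext {M : Type*} [CommMonoid M] {Q R : Forest → M} (hQ : IsMultiplicative Q)
    (hR : IsMultiplicative R) (h : ∀ t : RTree, Q t.rep = R t.rep) (F : Forest) : Q F = R F := by
  have hrep := fun {F : Forest} (hF : F.IsTree) => RTree.rep_mk_iso hF
  have htree : ∀ {F : Forest}, F.IsTree → Q F = R F := fun hF =>
    (hQ.map_iso (hrep hF)).symm.trans ((h _).trans (hR.map_iso (hrep hF)))
  induction hn : F.verts.card using Nat.strong_induction_on generalizing F with
  | h n ih =>
    obtain hF | ⟨x, hx⟩ := F.verts.eq_empty_or_nonempty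
    · rw [hQ.map_empty hF, hR.map_empty hF]
    · obtain ⟨r, hr, -⟩ := F.exists_root_le hx
      have hrF := F.roots_subset_verts hr
      have hsmaller : (F.restrict (F.verts \ F.verts.filter fun x => F.le r x)).verts.card < n := by
        rw [← hn]
        refine Finset.card_lt_card (Finset.ssubset_iff_of_subset Finset.inter_subset_left |>.2
          ⟨r, hrF, fun h => ?_⟩)
        exact (Finset.mem_sdiff.1 (Finset.mem_inter.1 h).2).2
          (Finset.mem_filter.2 ⟨hrF, F.le_refl r hrF⟩)
      rw [hQ.map_mul (isSaturated_above hr), hR.map_mul (isSaturated_above hr),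
        ih _ hsmaller _ rfl]
      exact congrArg (· * _) (htree (F.above_isTree hr))

end IsMultiplicative

theorem isMultiplicative_prod_component {M : Type*} [CommMonoid M] (g : RTree → M) :
    IsMultiplicative fun F => ∏ r : F.roots, g (F.component r) where
  map_iso := fun {F G} h => by
    obtain ⟨f, hf⟩ := h.exists_isoVia
    rw [prod_component, prod_component, ← hf.image_roots,
      Finset.prod_image (hf.injOn.mono F.roots_subset_verts)]
    refine Finset.prod_congr rfl fun r hr => congrArg g ?_
    exact componentAt_eq_of_iso hr (hf.image_roots ▸ Finset.mem_image_of_mem f hr)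
      (hf.above (F.roots_subset_verts hr)).iso
  map_empty := fun {F} h => by
    rw [prod_component, Finset.subset_empty.1 (F.roots_subset_verts.trans h.subset),
      Finset.prod_empty]
  map_mul := fun {F A} hA => by
    have hsdiff : F.roots \ A = F.roots ∩ (F.verts \ A) := by
      rw [← Finset.inter_sdiff_assoc, Finset.inter_eq_left.2 F.roots_subset_verts]
    rw [prod_component, prod_component, prod_component, roots_restrict hA,
      roots_restrict hA.verts_sdiff, ← Finset.prod_inter_mul_prod_sdiff F.roots A, hsdiff]
    congr 1
    · exact Finset.prod_congr rfl fun r hr => by rw [componentAt_restrict hA hr]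
    · exact Finset.prod_congr rfl fun r hr => by rw [componentAt_restrict hA.verts_sdiff hr]

/-! ### Local decompositions of forests -/

/-- A choice of sets of vertices in each forest which is invariant under isomorphism and which, on a
disjoint union, amounts to an independent choice in each of the two parts. -/
structure IsLocalFamily (𝒮 : Forest → Finset (Finset ℕ)) : Prop where
  subset_verts : ∀ {F : Forest} {S : Finset ℕ}, S ∈ 𝒮 F → S ⊆ F.verts
  empty_mem : ∀ F : Forest, ∅ ∈ 𝒮 F
  image_mem_iff : ∀ {f : ℕ → ℕ} {F G : Forest}, IsoVia f F G → ∀ {S : Finset ℕ}, S ⊆ F.verts →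
    (S.image f ∈ 𝒮 G ↔ S ∈ 𝒮 F)
  mem_iff : ∀ {F : Forest} {A S : Finset ℕ}, F.IsSaturated A → S ⊆ F.verts →
    (S ∈ 𝒮 F ↔ S ∩ A ∈ 𝒮 (F.restrict A) ∧ S ∩ (F.verts \ A) ∈ 𝒮 (F.restrict (F.verts \ A)))

namespace IsLocalFamily

variable {𝒮 : Forest → Finset (Finset ℕ)} (h𝒮 : IsLocalFamily 𝒮)
include h𝒮

theorem eq_singleton_empty {F : Forest} (hF : F.verts = ∅) : 𝒮 F = {∅} :=
  Finset.eq_singleton_iff_unique_mem.2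
    ⟨h𝒮.empty_mem F, fun _ hS => Finset.subset_empty.1 (hF ▸ h𝒮.subset_verts hS)⟩

theorem sum_image {M : Type*} [AddCommMonoid M] {f : ℕ → ℕ} {F G : Forest} (h : IsoVia f F G)
    (g : Finset ℕ → M) : ∑ S ∈ 𝒮 F, g (S.image f) = ∑ S ∈ 𝒮 G, g S := by
  refine Finset.sum_nbij (Finset.image f) (fun S hS => ?_) (fun S hS T hT hST => ?_)
    (fun S hS => ?_) (fun _ _ => rfl)
  · exact (h𝒮.image_mem_iff h (h𝒮.subset_verts hS)).2 hS
  · exact h.image_injOn (h𝒮.subset_verts hS) (h𝒮.subset_verts hT) hST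
  · obtain ⟨T, hT, rfl⟩ := h.exists_image_eq (h𝒮.subset_verts hS)
    exact ⟨T, (h𝒮.image_mem_iff h hT).1 hS, rfl⟩

theorem sum_eq_sum_sum {M : Type*} [AddCommMonoid M] {F : Forest} {A : Finset ℕ}
    (hA : F.IsSaturated A) (g : Finset ℕ → Finset ℕ → M) :
    ∑ S ∈ 𝒮 F, g (S ∩ A) (S ∩ (F.verts \ A)) =
      ∑ S ∈ 𝒮 (F.restrict A), ∑ T ∈ 𝒮 (F.restrict (F.verts \ A)), g S T := by
  rw [Finset.sum_sigma']
  have hsplit {S T : Finset ℕ} (hS : S ∈ 𝒮 (F.restrict A))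
      (hT : T ∈ 𝒮 (F.restrict (F.verts \ A))) :
      S ∪ T ⊆ F.verts ∧ (S ∪ T) ∩ A = S ∧ (S ∪ T) ∩ (F.verts \ A) = T := by
    have hS := fun x => @h𝒮.subset_verts _ _ hS x
    have hT := fun x => @h𝒮.subset_verts _ _ hT x
    simp only [restrict_verts, Finset.mem_inter, Finset.mem_sdiff] at hS hT
    refine ⟨fun x => ?_, Finset.ext fun x => ?_, Finset.ext fun x => ?_⟩ <;>
      simp only [Finset.mem_union, Finset.mem_inter, Finset.mem_sdiff] <;> grind
  refine Finset.sum_bij' (fun S _ => ⟨S ∩ A, S ∩ (F.verts \ A)⟩) (fun p _ => p.1 ∪ p.2)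
    (fun S hS => ?_) (fun p hp => ?_) (fun S hS => ?_) (fun p hp => ?_) (fun _ _ => rfl)
  · exact Finset.mem_sigma.2 ((h𝒮.mem_iff hA (h𝒮.subset_verts hS)).1 hS)
  · obtain ⟨hS, hT⟩ := Finset.mem_sigma.1 hp
    obtain ⟨hsub, hSA, hTA⟩ := hsplit hS hT
    exact (h𝒮.mem_iff hA hsub).2 ⟨hSA.symm ▸ hS, hTA.symm ▸ hT⟩
  · dsimp only
    rw [← Finset.inter_union_distrib_left, Finset.union_sdiff_self_eq_union]
    exact Finset.inter_eq_left.2 ((h𝒮.subset_verts hS).trans Finset.subset_union_right)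
  · obtain ⟨hS, hT⟩ := Finset.mem_sigma.1 hp
    obtain ⟨-, hSA, hTA⟩ := hsplit hS hT
    exact Sigma.ext hSA (heq_of_eq hTA)

end IsLocalFamily

/-- An operation on forests equipped with a set of vertices which is invariant under isomorphism and
which, on a disjoint union, is performed separately in each of the two parts. -/
structure IsLocalOperation (P : Forest → Finset ℕ → Forest) : Prop where
  verts_subset : ∀ (F : Forest) (S : Finset ℕ), (P F S).verts ⊆ F.verts
  le_of_le : ∀ {F : Forest} {S : Finset ℕ} {x y : ℕ}, (P F S).le x y → F.le x y
  isoVia : ∀ {f : ℕ → ℕ} {F G : Forest}, IsoVia f F G → ∀ {S : Finset ℕ}, S ⊆ F.verts →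
    IsoVia f (P F S) (P G (S.image f))
  restrict_iso : ∀ {F : Forest} {A : Finset ℕ} (S : Finset ℕ), F.IsSaturated A →
    ((P F S).restrict A).Iso (P (F.restrict A) (S ∩ A))

theorem IsMultiplicative.map_mul_localOperation {M : Type*} [CommMonoid M] {Q : Forest → M}
    (hQ : IsMultiplicative Q) {P : Forest → Finset ℕ → Forest} (hP : IsLocalOperation P)
    {F : Forest} {A : Finset ℕ} (hA : F.IsSaturated A) (S : Finset ℕ) :
    Q (P F S) =
      Q (P (F.restrict A) (S ∩ A)) * Q (P (F.restrict (F.verts \ A)) (S ∩ (F.verts \ A))) := by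
  have hAP : (P F S).IsSaturated A := fun x hx y hy hxy =>
    hA x (hP.verts_subset F S hx) y (hP.verts_subset F S hy) (hP.le_of_le hxy)
  have hcompl : (P F S).restrict ((P F S).verts \ A) = (P F S).restrict (F.verts \ A) := by
    refine restrict_congr _ (Finset.ext fun x => ?_)
    have := @hP.verts_subset F S x
    simp only [Finset.mem_inter, Finset.mem_sdiff]
    tauto
  rw [hQ.map_mul hAP, hcompl, hQ.map_iso (hP.restrict_iso S hA),
    hQ.map_iso (hP.restrict_iso S hA.verts_sdiff)]

theorem IsMultiplicative.sum {M : Type*} [CommSemiring M] {Q R : Forest → M}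
    (hQ : IsMultiplicative Q) (hR : IsMultiplicative R) {𝒮 : Forest → Finset (Finset ℕ)}
    (h𝒮 : IsLocalFamily 𝒮) {P P' : Forest → Finset ℕ → Forest} (hP : IsLocalOperation P)
    (hP' : IsLocalOperation P') :
    IsMultiplicative fun F => ∑ S ∈ 𝒮 F, Q (P F S) * R (P' F S) where
  map_iso := fun {F G} h => by
    obtain ⟨f, hf⟩ := h.exists_isoVia
    rw [← h𝒮.sum_image hf]
    refine Finset.sum_congr rfl fun S hS => ?_
    have hSF := h𝒮.subset_verts hS
    rw [hQ.map_iso (hP.isoVia hf hSF).iso, hR.map_iso (hP'.isoVia hf hSF).iso]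
  map_empty := fun {F} h => by
    rw [h𝒮.eq_singleton_empty h, Finset.sum_singleton,
      hQ.map_empty (Finset.subset_empty.1 ((hP.verts_subset F ∅).trans h.subset)),
      hR.map_empty (Finset.subset_empty.1 ((hP'.verts_subset F ∅).trans h.subset)), mul_one]
  map_mul := fun {F A} hA => by
    rw [Finset.sum_mul_sum, ← h𝒮.sum_eq_sum_sum hA]
    refine Finset.sum_congr rfl fun S _ => ?_
    rw [hQ.map_mul_localOperation hP hA, hR.map_mul_localOperation hP' hA, mul_mul_mul_comm]

theorem isLocalFamily_crowns : IsLocalFamily crowns where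
  subset_verts hS := (mem_crowns.1 hS).1
  empty_mem F := mem_crowns.2 ⟨Finset.empty_subset _, fun _ hx => absurd hx (Finset.notMem_empty _)⟩
  image_mem_iff h S hS := by rw [mem_crowns, mem_crowns, h.isUpper_image_iff hS]
  mem_iff := fun {F A S} hA hS => by
    simp only [mem_crowns, IsUpper, restrict_verts, Finset.mem_inter, Finset.mem_sdiff]
    refine ⟨fun ⟨_, H⟩ => ⟨⟨Finset.inter_subset_inter_right hS, fun x hx y hy hxy =>
      ⟨H x hx.1 y hy.1 hxy, hy.2⟩⟩, Finset.inter_subset_inter_right hS, fun x hx y hy hxy =>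
      ⟨H x hx.1 y hy.1 hxy, hy.2⟩⟩, fun ⟨⟨_, H₁⟩, _, H₂⟩ => ⟨hS, fun x hx y hy hxy => ?_⟩⟩
    have hxF := hS hx
    have hxy' := hA x hxF y hy hxy
    by_cases hyA : y ∈ A
    · exact (H₁ x ⟨hx, hxy'.2 hyA⟩ y ⟨hy, hyA⟩ hxy).1
    · exact (H₂ x ⟨hx, hxF, mt hxy'.1 hyA⟩ y ⟨hy, hy, hyA⟩ hxy).1

theorem isLocalFamily_powerset_edges : IsLocalFamily fun F => F.edges.powerset where
  subset_verts := fun {F _} hS => (Finset.mem_powerset.1 hS).trans F.edges_subset_verts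
  empty_mem F := Finset.empty_mem_powerset _
  image_mem_iff := fun {f F G} h S hS => by
    rw [Finset.mem_powerset, Finset.mem_powerset, ← h.image_edges]
    refine ⟨fun H x hx => ?_, Finset.image_subset_image⟩
    exact (h.apply_mem_image_iff F.edges_subset_verts (hS hx)).1 (H (Finset.mem_image_of_mem f hx))
  mem_iff := fun {F A S} hA hS => by
    simp only [Finset.mem_powerset, edges_restrict hA, edges_restrict hA.verts_sdiff]
    refine ⟨fun h => ⟨Finset.inter_subset_inter_right h, Finset.inter_subset_inter_right h⟩,
      fun ⟨h₁, h₂⟩ x hx => ?_⟩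
    by_cases hxA : x ∈ A
    · exact (Finset.mem_inter.1 (h₁ (Finset.mem_inter.2 ⟨hx, hxA⟩))).1
    · exact (Finset.mem_inter.1 (h₂ (Finset.mem_inter.2
        ⟨hx, Finset.mem_sdiff.2 ⟨hS hx, hxA⟩⟩))).1

theorem isoVia_spanning_restrict {F : Forest} {A : Finset ℕ}
    (hA : ∀ x ∈ F.verts, ∀ y ∈ F.verts, ∀ z ∈ F.verts, x ∈ A → z ∈ A → F.le x y → F.le y z → y ∈ A)
    (S : Finset ℕ) :
    IsoVia id ((F.spanning S).restrict A) ((F.restrict A).spanning (S ∩ A)) := by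
  refine isoVia_id rfl fun x hx y hy => and_congr_right fun _ => ?_
  obtain ⟨hxF, hxA⟩ := Finset.mem_inter.1 hx
  obtain ⟨hyF, hyA⟩ := Finset.mem_inter.1 hy
  constructor
  · intro H z hz hxz hne hzy
    obtain ⟨hzF, hzA⟩ := Finset.mem_inter.1 hz
    exact Finset.mem_inter.2 ⟨H z hzF hxz hne hzy, hzA⟩
  · intro H z hz hxz hne hzy
    exact (Finset.mem_inter.1
      (H z (Finset.mem_inter.2 ⟨hz, hA x hxF z hz y hyF hxA hyA hxz hzy⟩) hxz hne hzy)).1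

theorem isLocalOperation_spanning : IsLocalOperation spanning where
  verts_subset _ _ := subset_rfl
  le_of_le h := h.1
  isoVia h _ hS := h.spanning hS
  restrict_iso S hA := (isoVia_spanning_restrict
    (fun x hx y hy _ _ hxA _ hxy _ => (hA x hx y hy hxy).1 hxA) S).iso

theorem isLocalOperation_restrict : IsLocalOperation restrict where
  verts_subset _ _ := Finset.inter_subset_left
  le_of_le h := h
  isoVia h _ hS := h.restrict hS
  restrict_iso := fun {F A} S _ => by
    rw [restrict_restrict, restrict_restrict, Finset.inter_comm S, ← Finset.inter_assoc,
      Finset.inter_self, Finset.inter_comm]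
    exact Iso.refl _

theorem isLocalOperation_contract : IsLocalOperation contract where
  verts_subset F S := F.contract_verts S ▸ Finset.sdiff_subset
  le_of_le h := h
  isoVia h _ hS := h.contract hS
  restrict_iso := fun {F A} S _ => by
    have heq : (F.contract S).restrict A = (F.restrict A).contract (S ∩ A) :=
      ext_of_verts_le (by
        ext x
        simp only [restrict_verts, contract_verts, Finset.mem_inter, Finset.mem_sdiff]
        tauto) rfl
    rw [heq]
    exact Iso.refl _

/-! ### Cutting and contracting -/

theorem isUpper_restrict_iff {F : Forest} {V U : Finset ℕ} (hV : F.IsUpper V) :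
    (F.restrict V).IsUpper U ↔ U ⊆ V ∧ F.IsUpper U := by
  simp only [IsUpper, restrict_verts, Finset.subset_inter_iff, Finset.mem_inter]
  constructor
  · rintro ⟨⟨hUF, hUV⟩, H⟩
    exact ⟨hUV, hUF, fun x hx y hy hxy => H x hx y ⟨hy, hV.2 x (hUV hx) y hy hxy⟩ hxy⟩
  · rintro ⟨hUV, hUF, H⟩
    exact ⟨⟨hUF, hUV⟩, fun x hx y hy => H x hx y hy.1⟩

theorem isUpper_contract_iff {F : Forest} {V W : Finset ℕ} (hV : F.IsUpper V) :
    (F.contract V).IsUpper W ↔ Disjoint W V ∧ F.IsUpper (V ∪ W) := by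
  simp only [IsUpper, contract_verts, Finset.subset_sdiff, Finset.mem_sdiff, Finset.mem_union,
    Finset.union_subset_iff]
  constructor
  · rintro ⟨⟨hWF, hWV⟩, H⟩
    refine ⟨hWV, ⟨hV.1, hWF⟩, fun x hx y hy hxy => ?_⟩
    by_cases hyV : y ∈ V
    · exact Or.inl hyV
    · exact Or.inr (H x (hx.resolve_left fun hxV => hyV (hV.2 x hxV y hy hxy)) y ⟨hy, hyV⟩ hxy)
  · rintro ⟨hWV, ⟨-, hWF⟩, H⟩
    exact ⟨⟨hWF, hWV⟩, fun x hx y hy hxy => (H x (Or.inr hx) y hy.1 hxy).resolve_left hy.2⟩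

theorem restrict_contract (F : Forest) (A B : Finset ℕ) :
    (F.contract A).restrict B = F.restrict (B \ A) :=
  ext_of_verts_le (by
    rw [restrict_verts, restrict_verts, contract_verts, Finset.inter_comm,
      ← Finset.inter_sdiff_assoc, ← Finset.inter_sdiff_assoc, Finset.inter_comm]) rfl

theorem contract_restrict (F : Forest) (A B : Finset ℕ) :
    (F.restrict A).contract B = F.restrict (A \ B) :=
  ext_of_verts_le (by
    rw [contract_verts, restrict_verts, restrict_verts, Finset.inter_sdiff_assoc]) rfl

theorem contract_contract (F : Forest) (A B : Finset ℕ) :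
    (F.contract A).contract B = F.contract (A ∪ B) :=
  ext_of_verts_le (by
    rw [contract_verts, contract_verts, contract_verts]
    exact sdiff_sdiff_left) rfl

theorem sum_crowns_restrict_eq_sum_crowns_contract {M : Type*} [AddCommMonoid M] (F : Forest)
    (g : Forest → Forest → Forest → M) :
    ∑ V ∈ F.crowns, ∑ U ∈ (F.restrict V).crowns,
        g ((F.restrict V).restrict U) ((F.restrict V).contract U) (F.contract V) =
      ∑ V ∈ F.crowns, ∑ W ∈ (F.contract V).crowns,
        g (F.restrict V) ((F.contract V).restrict W) ((F.contract V).contract W) := by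
  rw [Finset.sum_sigma', Finset.sum_sigma']
  refine Finset.sum_bij' (fun p _ => ⟨p.2, p.1 \ p.2⟩) (fun p _ => ⟨p.1 ∪ p.2, p.1⟩)
    (fun p hp => ?_) (fun p hp => ?_) (fun p hp => ?_) (fun p hp => ?_) (fun p hp => ?_) <;>
  obtain ⟨hV, hU⟩ := Finset.mem_sigma.1 hp <;> rw [mem_crowns] at hV hU
  · obtain ⟨hUV, hU⟩ := (isUpper_restrict_iff hV).1 hU
    refine Finset.mem_sigma.2 ⟨mem_crowns.2 hU, mem_crowns.2 ((isUpper_contract_iff hU).2 ?_)⟩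
    exact ⟨Finset.sdiff_disjoint, by rwa [Finset.union_sdiff_of_subset hUV]⟩
  · obtain ⟨-, hVW⟩ := (isUpper_contract_iff hV).1 hU
    exact Finset.mem_sigma.2 ⟨mem_crowns.2 hVW,
      mem_crowns.2 ((isUpper_restrict_iff hVW).2 ⟨Finset.subset_union_left, hV⟩)⟩
  · obtain ⟨hUV, -⟩ := (isUpper_restrict_iff hV).1 hU
    exact Sigma.ext (Finset.union_sdiff_of_subset hUV) HEq.rfl
  · obtain ⟨hWV, -⟩ := (isUpper_contract_iff hV).1 hU
    exact Sigma.ext rfl (heq_of_eq (Finset.union_sdiff_cancel_left hWV.symm))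
  · obtain ⟨hUV, -⟩ := (isUpper_restrict_iff hV).1 hU
    rw [restrict_restrict, Finset.inter_eq_right.2 hUV, contract_restrict, restrict_contract,
      Finset.sdiff_idem, contract_contract, Finset.union_sdiff_of_subset hUV]

/-- The set of vertices which lie above an element of `V`: this recovers a crown from what is left
of it after contracting edges. -/
def upClosure (F : Forest) (V : Finset ℕ) : Finset ℕ :=
  F.verts.filter fun z => ∃ y ∈ V, F.le y z

theorem mem_upClosure {F : Forest} {V : Finset ℕ} {z : ℕ} :
    z ∈ F.upClosure V ↔ z ∈ F.verts ∧ ∃ y ∈ V, F.le y z :=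
  Finset.mem_filter

theorem subset_upClosure {F : Forest} {V : Finset ℕ} (hV : V ⊆ F.verts) : V ⊆ F.upClosure V :=
  fun x hx => mem_upClosure.2 ⟨hV hx, x, hx, F.le_refl x (hV hx)⟩

theorem isUpper_upClosure {F : Forest} {V : Finset ℕ} (hV : V ⊆ F.verts) :
    F.IsUpper (F.upClosure V) := by
  refine ⟨Finset.filter_subset _ _, fun x hx y hy hxy => ?_⟩
  obtain ⟨hxF, w, hw, hwx⟩ := mem_upClosure.1 hx
  exact mem_upClosure.2 ⟨hy, w, hw, F.le_trans w (hV hw) x hxF y hy hwx hxy⟩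

theorem roots_restrict_upClosure_subset {F : Forest} {V : Finset ℕ} (hV : V ⊆ F.verts) :
    (F.restrict (F.upClosure V)).roots ⊆ V := by
  intro x hx
  obtain ⟨hx, hmin⟩ := mem_roots.1 hx
  obtain ⟨-, y, hy, hyx⟩ := mem_upClosure.1 (Finset.mem_inter.1 hx).2
  exact hmin y (Finset.mem_inter.2 ⟨hV hy, subset_upClosure hV hy⟩) hyx ▸ hy

theorem upClosure_sdiff_of_isUpper_contract {F : Forest} {S U : Finset ℕ}
    (hU : (F.contract S).IsUpper U) : F.upClosure U \ S = U := by
  have hUF := contract_verts F S ▸ hU.1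
  ext x
  refine Finset.mem_sdiff.trans ⟨fun ⟨hx, hxS⟩ => ?_, fun hx => ?_⟩
  · obtain ⟨hxF, y, hy, hyx⟩ := mem_upClosure.1 hx
    exact hU.2 y hy x (contract_verts F S ▸ Finset.mem_sdiff.2 ⟨hxF, hxS⟩) hyx
  · exact ⟨subset_upClosure (hUF.trans Finset.sdiff_subset) hx, (Finset.mem_sdiff.1 (hUF hx)).2⟩

theorem edges_restrict_subset (F : Forest) (A : Finset ℕ) : (F.restrict A).edges ⊆ F.edges := by
  intro x hx
  obtain ⟨hx, y, hy, hyx, hne⟩ := mem_edges.1 hx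
  exact mem_edges.2 ⟨(Finset.mem_inter.1 hx).1, y, (Finset.mem_inter.1 hy).1, hyx, hne⟩

namespace IsUpper

variable {F : Forest} {V : Finset ℕ} (hV : F.IsUpper V)
include hV

theorem exists_root_restrict_le {x : ℕ} (hx : x ∈ V) :
    ∃ r ∈ (F.restrict V).roots, r ∈ F.verts ∧ r ∈ V ∧ F.le r x := by
  obtain ⟨r, hr, hrx⟩ := (F.restrict V).exists_root_le (Finset.mem_inter.2 ⟨hV.1 hx, hx⟩)
  have hrV := Finset.mem_inter.1 (roots_subset_verts _ hr)
  exact ⟨r, hr, hrV.1, hrV.2, hrx⟩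

theorem contract_sdiff (S : Finset ℕ) : (F.contract S).IsUpper (V \ S) := by
  rw [IsUpper, contract_verts]
  refine ⟨Finset.sdiff_subset_sdiff hV.1 subset_rfl, fun x hx y hy hxy => ?_⟩
  obtain ⟨hyF, hyS⟩ := Finset.mem_sdiff.1 hy
  exact Finset.mem_sdiff.2 ⟨hV.2 x (Finset.mem_sdiff.1 hx).1 y hyF hxy, hyS⟩

theorem upClosure_sdiff {S : Finset ℕ} (hS : Disjoint S (F.restrict V).roots) :
    F.upClosure (V \ S) = V := by
  ext x
  refine mem_upClosure.trans ⟨fun ⟨hx, y, hy, hyx⟩ => ?_, fun hx => ⟨hV.1 hx, ?_⟩⟩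
  · exact hV.2 y (Finset.mem_sdiff.1 hy).1 x hx hyx
  · obtain ⟨r, hr, -, hrV, hrx⟩ := hV.exists_root_restrict_le hx
    exact ⟨r, Finset.mem_sdiff.2 ⟨hrV, Finset.disjoint_right.1 hS hr⟩, hrx⟩

theorem edges_sdiff_roots_restrict :
    F.edges \ (F.restrict V).roots = (F.restrict V).edges ∪ (F.contract V).edges := by
  ext x
  rw [Finset.mem_sdiff, Finset.mem_union]
  constructor
  · rintro ⟨hx, hxr⟩
    obtain ⟨hxF, y, hy, hyx, hne⟩ := mem_edges.1 hx
    by_cases hxV : x ∈ V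
    · exact Or.inl (Finset.mem_sdiff.2 ⟨Finset.mem_inter.2 ⟨hxF, hxV⟩, hxr⟩)
    · have hyV : y ∉ V := fun hyV => hxV (hV.2 y hyV x hxF hyx)
      refine Or.inr (mem_edges.2 ?_)
      rw [contract_verts, Finset.mem_sdiff]
      exact ⟨⟨hxF, hxV⟩, y, Finset.mem_sdiff.2 ⟨hy, hyV⟩, hyx, hne⟩
  · rintro (hx | hx)
    · exact ⟨edges_restrict_subset F V hx, (Finset.mem_sdiff.1 hx).2⟩
    · have hxV := contract_verts F V ▸ edges_subset_verts _ hx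
      exact ⟨edges_restrict_subset F _ hx, fun hxr => (Finset.mem_sdiff.1 hxV).2
        (Finset.mem_inter.1 (roots_subset_verts _ hxr)).2⟩

theorem isSaturated_spanning {S : Finset ℕ} (hS : Disjoint S (F.restrict V).roots) :
    (F.spanning S).IsSaturated V := by
  refine fun x hx y hy hxy => ⟨fun hxV => hV.2 x hxV y hy hxy.1, fun hyV => ?_⟩
  obtain ⟨r, hr, hrF, hrV, hry⟩ := hV.exists_root_restrict_le hyV
  by_contra hxV
  have hxr : F.le x r := (F.le_chain x hx r hrF y hy hxy.1 hry).resolve_right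
    fun hrx => hxV (hV.2 r hrV x hx hrx)
  exact Finset.disjoint_right.1 hS hr (hxy.2 r hrF hxr (fun h => hxV (h ▸ hrV)) hry)

end IsUpper

theorem IsMultiplicative.map_spanning {M : Type*} [CommMonoid M] {Q : Forest → M}
    (hQ : IsMultiplicative Q) {F : Forest} {V S : Finset ℕ} (hV : F.IsUpper V)
    (hS : Disjoint S (F.restrict V).roots) :
    Q (F.spanning S) = Q ((F.restrict V).spanning (S ∩ V)) *
      Q ((F.contract V).spanning (S ∩ (F.verts \ V))) := by
  rw [hQ.map_mul (hV.isSaturated_spanning hS)]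
  congr 1
  · refine hQ.map_iso (isoVia_spanning_restrict (fun x _ y hy _ _ hx _ hxy _ => ?_) S).iso
    exact hV.2 x hx y hy hxy
  · refine hQ.map_iso (isoVia_spanning_restrict (fun _ _ y hy z hz _ hzV _ hyz => ?_) S).iso
    exact Finset.mem_sdiff.2 ⟨hy, fun hyV => (Finset.mem_sdiff.1 hzV).2 (hV.2 y hyV z hz hyz)⟩

theorem sum_crowns_contract {M : Type*} [AddCommMonoid M] {F : Forest} {S : Finset ℕ}
    (g : Finset ℕ → M) :
    ∑ U ∈ (F.contract S).crowns, g U =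
      ∑ V ∈ F.crowns with Disjoint S (F.restrict V).roots, g (V \ S) := by
  symm
  refine Finset.sum_bij' (fun V _ => V \ S) (fun U _ => F.upClosure U) (fun V hV => ?_)
    (fun U hU => ?_) (fun V hV => ?_) (fun U hU => ?_) (fun _ _ => rfl)
  · exact mem_crowns.2 ((mem_crowns.1 (Finset.mem_filter.1 hV).1).contract_sdiff S)
  · have hUF := contract_verts F S ▸ (mem_crowns.1 hU).1
    have hUF' := hUF.trans Finset.sdiff_subset
    refine Finset.mem_filter.2 ⟨mem_crowns.2 (isUpper_upClosure hUF'), ?_⟩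
    exact (Finset.disjoint_of_subset_left (roots_restrict_upClosure_subset hUF')
      (Finset.disjoint_of_subset_left hUF Finset.sdiff_disjoint)).symm
  · obtain ⟨hV, hVS⟩ := Finset.mem_filter.1 hV
    exact (mem_crowns.1 hV).upClosure_sdiff hVS
  · exact upClosure_sdiff_of_isUpper_contract (mem_crowns.1 hU)

theorem sum_powerset_edges_sum_crowns {R M : Type*} [CommSemiring R] [AddCommMonoid M] [Module R M]
    {Q : Forest → R} (hQ : IsMultiplicative Q) (g : Forest → Forest → M) (F : Forest) :
    ∑ S ∈ F.edges.powerset, ∑ U ∈ (F.contract S).crowns,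
        Q (F.spanning S) • g ((F.contract S).restrict U) ((F.contract S).contract U) =
      ∑ V ∈ F.crowns, ∑ S ∈ (F.restrict V).edges.powerset, ∑ T ∈ (F.contract V).edges.powerset,
        (Q ((F.restrict V).spanning S) * Q ((F.contract V).spanning T)) •
          g ((F.restrict V).contract S) ((F.contract V).contract T) := by
  -- No edge of `S` is cut by `V` exactly when `S` misses the roots of the crown `V`, an edge being
  -- encoded as its upper end.
  have hcut : ∀ S V, S ∈ F.edges.powerset ∧ V ∈ {V ∈ F.crowns | Disjoint S (F.restrict V).roots} ↔
      S ∈ ((F.restrict V).edges ∪ (F.contract V).edges).powerset ∧ V ∈ F.crowns := fun S V => by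
    rw [Finset.mem_filter, Finset.mem_powerset, Finset.mem_powerset, and_left_comm, and_comm,
      ← Finset.subset_sdiff]
    refine and_congr_left fun hV => ?_
    rw [(mem_crowns.1 hV).edges_sdiff_roots_restrict]
  simp_rw [sum_crowns_contract]
  rw [Finset.sum_comm' hcut]
  refine Finset.sum_congr rfl fun V hV => ?_
  rw [mem_crowns] at hV
  have hV₁ : (F.restrict V).edges ⊆ V := (edges_subset_verts _).trans Finset.inter_subset_right
  have hV₂ : (F.contract V).edges ⊆ F.verts \ V := contract_verts F V ▸ edges_subset_verts _
  have hdisj : Disjoint (F.restrict V).edges (F.contract V).edges :=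
    Finset.disjoint_of_subset_left hV₁ (Finset.disjoint_of_subset_right hV₂ Finset.disjoint_sdiff)
  rw [sum_powerset_union_of_disjoint hdisj]
  refine Finset.sum_congr rfl fun S hS => Finset.sum_congr rfl fun T hT => ?_
  rw [Finset.mem_powerset] at hS hT
  have hSV := hS.trans hV₁
  have hTV := hT.trans hV₂
  have hST : Disjoint (S ∪ T) (F.restrict V).roots := by
    refine Finset.disjoint_of_subset_left (Finset.union_subset_union hS hT) ?_
    exact hV.edges_sdiff_roots_restrict ▸ Finset.sdiff_disjoint
  have hinter₁ : (S ∪ T) ∩ V = S := by grind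
  have hinter₂ : (S ∪ T) ∩ (F.verts \ V) = T := by grind
  have hsdiff : (V \ (S ∪ T)) \ (S ∪ T) = V \ S := by grind
  have hunion : S ∪ T ∪ V \ (S ∪ T) = V ∪ T := by grind
  rw [hQ.map_spanning hV hST, hinter₁, hinter₂, restrict_contract, contract_contract, hsdiff,
    hunion, contract_restrict, contract_contract]

theorem edges_spanning {F : Forest} {S : Finset ℕ} (hS : S ⊆ F.edges) :
    (F.spanning S).edges = S := by
  ext x
  refine mem_edges.trans ⟨fun ⟨hx, y, _, hyx, hne⟩ => ?_, fun hxS => ?_⟩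
  · exact hyx.2 x hx hyx.1 hne.symm (F.le_refl x hx)
  · obtain ⟨p, hp, hpx, hne, hparent⟩ := F.exists_parent (hS hxS)
    exact ⟨edges_subset_verts F (hS hxS), p, hp,
      ⟨hpx, fun z hz hpz hzp hzx => hparent z hz hpz hzp hzx ▸ hxS⟩, hne⟩

theorem edges_contract {F : Forest} {S : Finset ℕ} (hS : S ⊆ F.edges) :
    (F.contract S).edges = F.edges \ S := by
  ext x
  rw [Finset.mem_sdiff]
  refine ⟨fun hx => ⟨edges_restrict_subset F _ hx, ?_⟩, fun ⟨hx, hxS⟩ => mem_edges.2 ?_⟩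
  · exact (Finset.mem_sdiff.1 (contract_verts F S ▸ edges_subset_verts _ hx)).2
  · obtain ⟨hxF, hxr⟩ := Finset.mem_sdiff.1 hx
    obtain ⟨r, hr, hrx⟩ := F.exists_root_le hxF
    have hrS : r ∉ S := fun h => (Finset.mem_sdiff.1 (hS h)).2 hr
    rw [contract_verts]
    exact ⟨Finset.mem_sdiff.2 ⟨hxF, hxS⟩, r, Finset.mem_sdiff.2 ⟨F.roots_subset_verts hr, hrS⟩,
      hrx, fun h => hxr (h ▸ hr)⟩

theorem contract_empty (F : Forest) : F.contract ∅ = F :=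
  ext_of_verts_le (by rw [contract_verts, Finset.sdiff_empty]) rfl

theorem spanning_edges_iso (F : Forest) : (F.spanning F.edges).Iso F := by
  refine IsoVia.iso (f := id) (isoVia_id rfl fun x hx y _ => ⟨fun h => h.1, fun h => ⟨h, ?_⟩⟩)
  exact fun z hz hxz hne _ => mem_edges.2 ⟨hz, x, hx, hxz, hne.symm⟩

theorem IsTree.contract {F : Forest} (hF : F.IsTree) {S : Finset ℕ} (hS : S ⊆ F.edges) :
    (F.contract S).IsTree := by
  obtain ⟨r, hr, hle⟩ := hF
  have hrS : r ∉ S := fun h => (Finset.mem_sdiff.1 (hS h)).2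
    (roots_eq_singleton hr hle ▸ Finset.mem_singleton_self r)
  rw [IsTree, contract_verts]
  exact ⟨r, Finset.mem_sdiff.2 ⟨hr, hrS⟩, fun x hx => hle x (Finset.mem_sdiff.1 hx).1⟩

theorem edges_point : point.edges = ∅ :=
  Finset.sdiff_eq_empty_iff_subset.2 fun _ hx =>
    mem_roots.2 ⟨hx, fun _ _ h => h⟩

theorem IsTree.iso_point {F : Forest} (hF : F.IsTree) (hedges : F.edges = ∅) : F.Iso point := by
  obtain ⟨r, hr, hle⟩ := hF
  have hverts : F.verts = {r} := (Finset.sdiff_eq_empty_iff_subset.1 hedges).antisymm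
    F.roots_subset_verts |>.trans (roots_eq_singleton hr hle)
  have heq : ∀ x ∈ F.verts, x = r := fun x hx => Finset.mem_singleton.1 (hverts ▸ hx)
  refine IsoVia.iso (f := fun _ => 0) ⟨fun x hx y hy _ => (heq x hx).trans (heq y hy).symm, ?_,
    fun x hx y hy => iff_of_true (heq x hx ▸ hle y hy) rfl⟩
  rw [hverts, Finset.image_singleton, point]

end Forest

namespace RTree

open Forest

theorem mk_eq_dot_iff {F : Forest} (hF : F.IsTree) : mk hF = dot ↔ F.edges = ∅ := by
  refine ⟨fun h => ?_, fun h => mk_eq_mk (hF.iso_point h)⟩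
  have hiso : F.Iso point := Quotient.exact h
  obtain ⟨f, hf⟩ := hiso.exists_isoVia
  exact Finset.image_eq_empty.1 (hf.image_edges.trans edges_point)

theorem edges_rep_eq_empty_iff {t : RTree} : t.rep.edges = ∅ ↔ t = dot := by
  rw [← mk_eq_dot_iff t.isTree_rep, mk_rep]

end RTree

namespace Forest

theorem component_eq_dot {F : Forest} (hedges : F.edges = ∅) (r : F.roots) :
    F.component r = RTree.dot := by
  refine (RTree.mk_eq_dot_iff (F.above_isTree r.2)).2 ?_
  rw [above, edges_restrict (isSaturated_above r.2), hedges, Finset.empty_inter]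

theorem isMultiplicative_ite_eq_empty (M : Type*) [CommMonoidWithZero M] {s : Forest → Finset ℕ}
    (hsub : ∀ F, s F ⊆ F.verts)
    (himage : ∀ {f : ℕ → ℕ} {F G : Forest}, IsoVia f F G → (s F).image f = s G)
    (hrestrict : ∀ {F : Forest} {A : Finset ℕ}, F.IsSaturated A → s (F.restrict A) = s F ∩ A) :
    IsMultiplicative fun F => if s F = ∅ then (1 : M) else 0 where
  map_iso h := by
    obtain ⟨f, hf⟩ := h.exists_isoVia
    exact if_congr (by rw [← himage hf, Finset.image_eq_empty]) rfl rfl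
  map_empty {F} h := if_pos (Finset.subset_empty.1 (h ▸ hsub F))
  map_mul {F A} hA := by
    rw [ite_zero_mul_ite_zero, mul_one, hrestrict hA, hrestrict hA.verts_sdiff]
    refine if_congr ?_ rfl rfl
    rw [← Finset.union_eq_empty, ← Finset.inter_union_distrib_left,
      Finset.union_sdiff_self_eq_union,
      Finset.inter_eq_left.2 ((hsub F).trans Finset.subset_union_right)]

theorem isMultiplicative_ite_edges_eq_empty (M : Type*) [CommMonoidWithZero M] :
    IsMultiplicative fun F => if F.edges = ∅ then (1 : M) else 0 :=
  isMultiplicative_ite_eq_empty M edges_subset_verts IsoVia.image_edges edges_restrict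

theorem isMultiplicative_ite_verts_eq_empty (M : Type*) [CommMonoidWithZero M] :
    IsMultiplicative fun F => if F.verts = ∅ then (1 : M) else 0 :=
  isMultiplicative_ite_eq_empty M (fun _ => subset_rfl) IsoVia.image_verts fun _ => rfl

end Forest

/-! ### Infinitesimal characters of polynomial algebras -/

section Augmentation

variable {R σ : Type*} [CommSemiring R]

variable (R σ) in
/-- The augmentation of a polynomial algebra, which sends a polynomial to its constant coefficient:
the co-unit of both `H` and `HCK`, as an algebra morphism. -/
def augmentation : MvPolynomial σ R →ₐ[R] R := MvPolynomial.aeval 0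

theorem augmentation_X (i : σ) : augmentation R σ (MvPolynomial.X i) = 0 :=
  MvPolynomial.aeval_X _ i

variable (R σ) in
theorem augmentation_toLinearMap :
    (augmentation R σ).toLinearMap = MvPolynomial.lcoeff R 0 := by
  refine LinearMap.ext fun p => ?_
  rw [AlgHom.toLinearMap_apply, augmentation, MvPolynomial.aeval_zero,
    Algebra.algebraMap_self_apply, MvPolynomial.constantCoeff_eq, MvPolynomial.lcoeff_apply]

theorem augmentation_monomial (m : σ →₀ ℕ) (a : R) :
    augmentation R σ (MvPolynomial.monomial m a) = if m = 0 then a else 0 := by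
  rw [← AlgHom.toLinearMap_apply, augmentation_toLinearMap, MvPolynomial.lcoeff_apply,
    MvPolynomial.coeff_monomial]

variable {M N : Type*} [AddCommMonoid M] [Module R M] [AddCommMonoid N] [Module R N]

/-- A linear map on a polynomial algebra which is a derivation over the augmentation, i.e. an
infinitesimal character when the target is `R`. -/
structure IsInfinitesimal (L : MvPolynomial σ R →ₗ[R] M) : Prop where
  map_one : L 1 = 0
  map_mul : ∀ p q, L (p * q) = augmentation R σ p • L q + augmentation R σ q • L p

theorem isInfinitesimal_of_degree_ne_one {L : MvPolynomial σ R →ₗ[R] M}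
    (h : ∀ m : σ →₀ ℕ, m.degree ≠ 1 → ∀ a, L (MvPolynomial.monomial m a) = 0) :
    IsInfinitesimal L := by
  have hzero : ∀ a, L (MvPolynomial.monomial 0 a) = 0 := h 0 (by simp)
  refine ⟨hzero 1, fun p q => ?_⟩
  induction p using MvPolynomial.induction_on' with
  | add p p' hp hp' => rw [add_mul, map_add, hp, hp', map_add, map_add, add_smul, smul_add]; abel
  | monomial m a =>
    induction q using MvPolynomial.induction_on' with
    | add q q' hq hq' => rw [mul_add, map_add, hq, hq', map_add, map_add, add_smul, smul_add]; abel
    | monomial n b =>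
      rw [MvPolynomial.monomial_mul, augmentation_monomial, augmentation_monomial]
      obtain rfl | hm := eq_or_ne m 0
      · rw [hzero, smul_zero, add_zero, zero_add, if_pos rfl, ← map_smul,
          MvPolynomial.smul_monomial, smul_eq_mul]
      obtain rfl | hn := eq_or_ne n 0
      · rw [hzero, smul_zero, zero_add, add_zero, if_pos rfl, ← map_smul,
          MvPolynomial.smul_monomial, smul_eq_mul, mul_comm]
      rw [if_neg hm, if_neg hn, zero_smul, zero_smul, add_zero]
      refine h _ (fun hdegree => ?_) _
      rw [map_add, Nat.add_eq_one_iff, Finsupp.degree_eq_zero_iff, Finsupp.degree_eq_zero_iff]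
        at hdegree
      exact hdegree.elim (hm ·.1) (hn ·.2)

namespace IsInfinitesimal

variable {L L' : MvPolynomial σ R →ₗ[R] M}

theorem comp (hL : IsInfinitesimal L) (f : M →ₗ[R] N) : IsInfinitesimal (f ∘ₗ L) where
  map_one := by rw [LinearMap.comp_apply, hL.map_one, map_zero]
  map_mul p q := by simp only [LinearMap.comp_apply, hL.map_mul, map_add, map_smul]

theorem ext (hL : IsInfinitesimal L) (hL' : IsInfinitesimal L')
    (h : ∀ i, L (MvPolynomial.X i) = L' (MvPolynomial.X i)) : L = L' := by
  refine LinearMap.ext fun p => ?_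
  induction p using MvPolynomial.induction_on with
  | C a => rw [← mul_one (MvPolynomial.C a), ← MvPolynomial.smul_eq_C_mul, map_smul, map_smul,
      hL.map_one, hL'.map_one]
  | add p q hp hq => rw [map_add, map_add, hp, hq]
  | mul_X p i hp => rw [hL.map_mul, hL'.map_mul, hp, h]

theorem lTensor_mul {B : Type*} [CommSemiring B] [Algebra R B] {L : MvPolynomial σ R →ₗ[R] R}
    (hL : IsInfinitesimal L) (z w : B ⊗[R] MvPolynomial σ R) :
    L.lTensor B (z * w) =
      Algebra.TensorProduct.map (AlgHom.id R B) (augmentation R σ) z * L.lTensor B w +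
      Algebra.TensorProduct.map (AlgHom.id R B) (augmentation R σ) w * L.lTensor B z := by
  induction z with
  | zero => simp only [zero_mul, map_zero, mul_zero, add_zero]
  | add x y hx hy => simp only [map_add, add_mul, mul_add, hx, hy]; abel
  | tmul x y =>
    induction w with
    | zero => simp only [zero_mul, map_zero, mul_zero, add_zero]
    | add u v hu hv => simp only [map_add, add_mul, mul_add, hu, hv]; abel
    | tmul u v =>
      simp only [Algebra.TensorProduct.tmul_mul_tmul, LinearMap.lTensor_tmul, hL.map_mul,
        Algebra.TensorProduct.map_tmul, AlgHom.id_apply, smul_eq_mul, TensorProduct.tmul_add,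
        mul_comm u x]

theorem lTensor_comp {τ B : Type*} [CommSemiring B] [Algebra R B] {L : MvPolynomial σ R →ₗ[R] R}
    (hL : IsInfinitesimal L) {Θ : MvPolynomial τ R →ₐ[R] B ⊗[R] MvPolynomial σ R}
    (hΘ : ∀ p, Algebra.TensorProduct.map (AlgHom.id R B) (augmentation R σ) (Θ p) =
      algebraMap R (B ⊗[R] R) (augmentation R τ p)) :
    IsInfinitesimal (L.lTensor B ∘ₗ Θ.toLinearMap) where
  map_one := by
    rw [LinearMap.comp_apply, AlgHom.toLinearMap_apply, _root_.map_one,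
      Algebra.TensorProduct.one_def, LinearMap.lTensor_tmul, hL.map_one, TensorProduct.tmul_zero]
  map_mul p q := by
    simp only [LinearMap.comp_apply, AlgHom.toLinearMap_apply, _root_.map_mul, hL.lTensor_mul, hΘ]
    exact (congrArg₂ (· + ·) (Algebra.smul_def _ _) (Algebra.smul_def _ _)).symm

end IsInfinitesimal

end Augmentation

section Monomials

variable (k : Type*) [Field k]

theorem isMultiplicative_toHCK : Forest.IsMultiplicative fun F => F.toHCK k :=
  Forest.isMultiplicative_prod_component MvPolynomial.X

theorem isMultiplicative_toH : Forest.IsMultiplicative fun F => F.toH k :=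
  Forest.isMultiplicative_prod_component (RTree.toH k)

theorem toHCK_of_isTree {F : Forest} (hF : F.IsTree) :
    F.toHCK k = MvPolynomial.X (RTree.mk hF) :=
  Forest.prod_component_of_isTree hF _

theorem toHCK_rep (t : RTree) : t.rep.toHCK k = MvPolynomial.X t := by
  rw [toHCK_of_isTree k t.isTree_rep, t.mk_rep]

theorem toH_of_isTree {F : Forest} (hF : F.IsTree) : F.toH k = (RTree.mk hF).toH k :=
  Forest.prod_component_of_isTree hF _

theorem toH_rep (t : RTree) : t.rep.toH k = t.toH k := by
  rw [toH_of_isTree k t.isTree_rep, t.mk_rep]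

theorem toH_dot : RTree.dot.toH k = 1 := dif_pos rfl

theorem toH_of_ne_dot {t : RTree} (ht : t ≠ RTree.dot) : t.toH k = MvPolynomial.X ⟨t, ht⟩ :=
  dif_neg ht

theorem toH_of_edges_eq_empty {F : Forest} (hF : F.edges = ∅) : F.toH k = 1 :=
  Finset.prod_eq_one fun r _ => by rw [Forest.component_eq_dot hF, toH_dot]

theorem augmentation_toHCK (F : Forest) :
    augmentation k _ (F.toHCK k) = if F.verts = ∅ then 1 else 0 := by
  refine ((isMultiplicative_toHCK k).comp (augmentation k RTree : HCK k →* k)).ext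
    (Forest.isMultiplicative_ite_verts_eq_empty k) (fun t => ?_) F
  obtain ⟨r, hr, -⟩ := t.isTree_rep
  rw [if_neg (Finset.ne_empty_of_mem hr), toHCK_rep]
  exact augmentation_X t

theorem augmentation_toH (F : Forest) :
    augmentation k _ (F.toH k) = if F.edges = ∅ then 1 else 0 := by
  refine ((isMultiplicative_toH k).comp
      (augmentation k {t : RTree // t ≠ RTree.dot} : H k →* k)).ext
    (Forest.isMultiplicative_ite_edges_eq_empty k) (fun t => ?_) F
  rw [toH_rep]
  split_ifs with ht
  · rw [RTree.edges_rep_eq_empty_iff.1 ht, toH_dot, map_one]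
  · rw [toH_of_ne_dot k (mt RTree.edges_rep_eq_empty_iff.2 ht)]
    exact augmentation_X _

theorem counitCK_eq_augmentation : counitCK k = (augmentation k RTree).toLinearMap :=
  (augmentation_toLinearMap k RTree).symm

theorem ZDot_eq_augmentation : ZDot k = (augmentation k _).toLinearMap :=
  (augmentation_toLinearMap k _).symm

theorem incl_apply (p : H k) :
    incl k p = MvPolynomial.rename Subtype.val p +
      augmentation k _ p • (MvPolynomial.X RTree.dot - 1) := by
  suffices incl k = (MvPolynomial.rename Subtype.val : H k →ₐ[k] HCK k).toLinearMap +
      (augmentation k _).toLinearMap.smulRight (MvPolynomial.X RTree.dot - 1) from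
    DFunLike.congr_fun this p
  refine (MvPolynomial.basisMonomials _ k).ext fun m => ?_
  rw [incl, Module.Basis.constr_basis, MvPolynomial.coe_basisMonomials, LinearMap.add_apply,
    LinearMap.smulRight_apply, AlgHom.toLinearMap_apply, AlgHom.toLinearMap_apply,
    augmentation_monomial]
  split_ifs with hm
  · subst hm
    exact .symm (.trans (congrArg₂ (· + ·) (map_one _) (one_smul _ _)) (add_sub_cancel _ _))
  · rw [zero_smul, add_zero]

theorem incl_toH (t : RTree) : incl k (t.toH k) = MvPolynomial.X t := by
  obtain rfl | ht := eq_or_ne t RTree.dot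
  · rw [toH_dot, incl_apply, map_one, map_one, one_smul, add_sub_cancel]
  · rw [toH_of_ne_dot k ht, incl_apply, MvPolynomial.rename_X, augmentation_X, zero_smul, add_zero]

theorem augmentation_incl (p : H k) : augmentation k _ (incl k p) = 0 := by
  have hrename : (augmentation k _).comp (MvPolynomial.rename Subtype.val) =
      augmentation k {t : RTree // t ≠ RTree.dot} :=
    MvPolynomial.algHom_ext fun t => by
      rw [AlgHom.comp_apply, MvPolynomial.rename_X, augmentation_X, augmentation_X]
  rw [incl_apply, map_add, map_smul, map_sub, augmentation_X, map_one, zero_sub, smul_neg,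
    smul_eq_mul, mul_one, ← hrename]
  exact add_neg_cancel _

theorem deltaDot_incl (p : H k) : deltaDot k (incl k p) = ZDot k p := by
  have hrename : deltaDot k (MvPolynomial.rename Subtype.val p) = 0 :=
    MvPolynomial.coeff_rename_eq_zero _ _ _ fun m hm => by
      have hdot := DFunLike.congr_fun hm RTree.dot
      rw [Finsupp.mapDomain_of_notMem_range _ _ (by simp), Finsupp.single_eq_same] at hdot
      exact absurd hdot zero_ne_one
  have hone : deltaDot k 1 = 0 := by
    rw [deltaDot, delta, MvPolynomial.lcoeff_apply, MvPolynomial.coeff_one,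
      if_neg (Finsupp.single_ne_zero.2 one_ne_zero).symm]
  have hX : deltaDot k (MvPolynomial.X RTree.dot) = 1 := by
    rw [deltaDot, delta, MvPolynomial.lcoeff_apply, MvPolynomial.coeff_X, if_pos rfl]
  rw [incl_apply, map_add, hrename, zero_add, map_smul, map_sub, hX, hone, sub_zero, smul_eq_mul,
    mul_one, ZDot_eq_augmentation, AlgHom.toLinearMap_apply]

theorem map_toHCK_eq_sum {A B : Type*} [CommSemiring A] [Algebra k A] [CommSemiring B] [Algebra k B]
    {Q : Forest → A} {R : Forest → B} (hQ : Forest.IsMultiplicative Q)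
    (hR : Forest.IsMultiplicative R) {𝒮 : Forest → Finset (Finset ℕ)}
    (h𝒮 : Forest.IsLocalFamily 𝒮) {P P' : Forest → Finset ℕ → Forest}
    (hP : Forest.IsLocalOperation P) (hP' : Forest.IsLocalOperation P')
    (Θ : HCK k →ₐ[k] A ⊗[k] B)
    (hΘ : ∀ t : RTree, Θ (MvPolynomial.X t) =
      ∑ S ∈ 𝒮 t.rep, Q (P t.rep S) ⊗ₜ[k] R (P' t.rep S)) (F : Forest) :
    Θ (F.toHCK k) = ∑ S ∈ 𝒮 F, Q (P F S) ⊗ₜ[k] R (P' F S) := by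
  have hsum := (hQ.comp (Algebra.TensorProduct.includeLeft : A →ₐ[k] A ⊗[k] B).toMonoidHom).sum
    (hR.comp (Algebra.TensorProduct.includeRight : B →ₐ[k] A ⊗[k] B).toMonoidHom) h𝒮 hP hP'
  have htmul (a : A) (b : B) :
      (Algebra.TensorProduct.includeLeft : A →ₐ[k] A ⊗[k] B).toMonoidHom a *
        (Algebra.TensorProduct.includeRight : B →ₐ[k] A ⊗[k] B).toMonoidHom b = a ⊗ₜ[k] b :=
    (Algebra.TensorProduct.tmul_mul_tmul ..).trans (by rw [mul_one, one_mul])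
  simp only [htmul] at hsum
  refine ((isMultiplicative_toHCK k).comp (Θ : HCK k →* A ⊗[k] B)).ext hsum (fun t => ?_) F
  rw [toHCK_rep]
  exact hΘ t

theorem coproductCK_toHCK (F : Forest) :
    coproductCK k (F.toHCK k) =
      ∑ V ∈ F.crowns, (F.restrict V).toHCK k ⊗ₜ[k] (F.contract V).toHCK k :=
  map_toHCK_eq_sum k (isMultiplicative_toHCK k) (isMultiplicative_toHCK k)
    Forest.isLocalFamily_crowns Forest.isLocalOperation_restrict Forest.isLocalOperation_contract
    (coproductCK k) (fun t => MvPolynomial.aeval_X _ t) F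

theorem coproduct_toH (t : RTree) :
    coproduct k (t.toH k) = ∑ S ∈ t.rep.edges.powerset,
      (t.rep.spanning S).toH k ⊗ₜ[k] (t.rep.contract S).toH k := by
  obtain rfl | ht := eq_or_ne t RTree.dot
  · have hedges := RTree.edges_rep_eq_empty_iff.2 (rfl : RTree.dot = RTree.dot)
    have hspanning := Forest.edges_spanning (Finset.empty_subset RTree.dot.rep.edges)
    rw [toH_dot, map_one, hedges, Finset.powerset_empty, Finset.sum_singleton,
      Forest.contract_empty, toH_of_edges_eq_empty k hspanning, toH_of_edges_eq_empty k hedges,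
      Algebra.TensorProduct.one_def]
  · rw [toH_of_ne_dot k ht]
    exact MvPolynomial.aeval_X _ _

theorem Phi_toHCK (F : Forest) :
    Phi k (F.toHCK k) = ∑ S ∈ F.edges.powerset,
      (F.spanning S).toH k ⊗ₜ[k] (F.contract S).toHCK k := by
  refine map_toHCK_eq_sum k (isMultiplicative_toH k) (isMultiplicative_toHCK k)
    Forest.isLocalFamily_powerset_edges Forest.isLocalOperation_spanning
    Forest.isLocalOperation_contract (Phi k) (fun t => ?_) F
  rw [Phi, MvPolynomial.aeval_X, coproduct_toH, map_sum]
  refine Finset.sum_congr rfl fun S hS => ?_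
  have htree := t.isTree_rep.contract (Finset.mem_powerset.1 hS)
  rw [LinearMap.lTensor_tmul, toH_of_isTree k htree, incl_toH, toHCK_of_isTree k htree]

end Monomials

/-! ### Co-unit laws and actions -/

section Counital

/-- The co-unit laws, with respect to the augmentation, of a coproduct on a polynomial algebra. -/
structure IsCounital {R σ : Type*} [CommSemiring R]
    (δ : MvPolynomial σ R →ₐ[R] MvPolynomial σ R ⊗[R] MvPolynomial σ R) : Prop where
  map_augmentation_id : ∀ p,
    Algebra.TensorProduct.map (augmentation R σ) (AlgHom.id R _) (δ p) = 1 ⊗ₜ p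
  map_id_augmentation : ∀ p,
    Algebra.TensorProduct.map (AlgHom.id R _) (augmentation R σ) (δ p) = p ⊗ₜ 1

theorem IsCounital.of_X {R σ : Type*} [CommSemiring R]
    {δ : MvPolynomial σ R →ₐ[R] MvPolynomial σ R ⊗[R] MvPolynomial σ R}
    (hleft : ∀ i, Algebra.TensorProduct.map (augmentation R σ) (AlgHom.id R _)
      (δ (MvPolynomial.X i)) = 1 ⊗ₜ MvPolynomial.X i)
    (hright : ∀ i, Algebra.TensorProduct.map (AlgHom.id R _) (augmentation R σ)
      (δ (MvPolynomial.X i)) = MvPolynomial.X i ⊗ₜ 1) : IsCounital δ where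
  map_augmentation_id := DFunLike.congr_fun (MvPolynomial.algHom_ext
    (f := (Algebra.TensorProduct.map (augmentation R σ) (AlgHom.id R _)).comp δ)
    (g := Algebra.TensorProduct.includeRight) hleft)
  map_id_augmentation := DFunLike.congr_fun (MvPolynomial.algHom_ext
    (f := (Algebra.TensorProduct.map (AlgHom.id R _) (augmentation R σ)).comp δ)
    (g := Algebra.TensorProduct.includeLeft) hright)

theorem IsCounital.comm {R σ : Type*} [CommSemiring R]
    {δ : MvPolynomial σ R →ₐ[R] MvPolynomial σ R ⊗[R] MvPolynomial σ R} (hδ : IsCounital δ) :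
    IsCounital ((Algebra.TensorProduct.comm R _ _).toAlgHom.comp δ) where
  map_augmentation_id p := by
    have h : (augmentation R σ).toLinearMap.lTensor _ (δ p) = p ⊗ₜ 1 := hδ.map_id_augmentation p
    have hcomm := LinearMap.rTensor_comm (augmentation R σ).toLinearMap (δ p)
    rw [h] at hcomm
    exact hcomm
  map_id_augmentation p := by
    have h : (augmentation R σ).toLinearMap.rTensor _ (δ p) = 1 ⊗ₜ p := hδ.map_augmentation_id p
    have hcomm := LinearMap.lTensor_comm (augmentation R σ).toLinearMap (δ p)
    rw [h] at hcomm
    exact hcomm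

variable (k : Type*) [Field k]

theorem isCounital_coproduct : IsCounital (coproduct k) := by
  refine .of_X (fun t => ?_) (fun t => ?_)
  · rw [← toH_of_ne_dot k t.2, coproduct_toH, map_sum, Finset.sum_eq_single ∅]
    · rw [Algebra.TensorProduct.map_tmul, augmentation_toH,
        if_pos (Forest.edges_spanning (Finset.empty_subset _)), Forest.contract_empty, toH_rep]
      rfl
    · intro S hS hne
      rw [Algebra.TensorProduct.map_tmul, augmentation_toH,
        Forest.edges_spanning (Finset.mem_powerset.1 hS), if_neg hne, TensorProduct.zero_tmul]
    · exact fun h => absurd (Finset.empty_mem_powerset _) h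
  · rw [← toH_of_ne_dot k t.2, coproduct_toH, map_sum, Finset.sum_eq_single t.1.rep.edges]
    · rw [Algebra.TensorProduct.map_tmul, augmentation_toH,
        if_pos (by rw [Forest.edges_contract subset_rfl, Finset.sdiff_self]),
        AlgHom.id_apply, (isMultiplicative_toH k).map_iso (Forest.spanning_edges_iso _), toH_rep]
    · intro S hS hne
      rw [Algebra.TensorProduct.map_tmul, augmentation_toH,
        Forest.edges_contract (Finset.mem_powerset.1 hS), if_neg, TensorProduct.tmul_zero]
      exact fun h =>
        hne ((Finset.mem_powerset.1 hS).antisymm (Finset.sdiff_eq_empty_iff_subset.1 h))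
    · exact fun h => absurd (Finset.mem_powerset_self _) h

theorem isCounital_coproductCK : IsCounital (coproductCK k) := by
  refine .of_X (fun t => ?_) (fun t => ?_)
  · rw [← toHCK_rep, coproductCK_toHCK, map_sum, Finset.sum_eq_single ∅]
    · rw [Algebra.TensorProduct.map_tmul, augmentation_toHCK,
        if_pos (by rw [Forest.restrict_verts, Finset.inter_empty]), Forest.contract_empty,
        AlgHom.id_apply]
    · intro V hV hne
      rw [Algebra.TensorProduct.map_tmul, augmentation_toHCK, Forest.restrict_verts,
        Finset.inter_eq_right.2 (Forest.mem_crowns.1 hV).1, if_neg hne, TensorProduct.zero_tmul]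
    · exact fun h => absurd (Forest.isLocalFamily_crowns.empty_mem _) h
  · rw [← toHCK_rep, coproductCK_toHCK, map_sum, Finset.sum_eq_single t.rep.verts]
    · have hrestrict : t.rep.restrict t.rep.verts = t.rep :=
        Forest.ext_of_verts_le (Finset.inter_self _) rfl
      rw [Algebra.TensorProduct.map_tmul, augmentation_toHCK, Forest.contract_verts,
        if_pos (Finset.sdiff_self _), AlgHom.id_apply, hrestrict]
    · intro V hV hne
      rw [Algebra.TensorProduct.map_tmul, augmentation_toHCK, Forest.contract_verts, if_neg,
        TensorProduct.tmul_zero]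
      exact fun h =>
        hne ((Forest.mem_crowns.1 hV).1.antisymm (Finset.sdiff_eq_empty_iff_subset.1 h))
    · exact fun h => absurd (Forest.mem_crowns.2 ⟨subset_rfl, fun _ _ y hy _ => hy⟩) h

end Counital

section Coaction

variable {k : Type*} [Field k] (δ : H k →ₐ[k] H k ⊗[k] H k)

/-- The algebra morphism `HCK → H ⊗ HCK` given by `δ` on the nonempty trees: it is `Φ` when `δ` is
the coproduct of `H`, and `Ψ`, up to the exchange of the two factors, when `δ` is the opposite
coproduct. -/
def coaction : HCK k →ₐ[k] H k ⊗[k] HCK k :=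
  MvPolynomial.aeval fun t => (incl k).lTensor (H k) (δ (t.toH k))

/-- The product of `α` and `b` defined by means of `coaction δ`, which unifies the left and right
actions of linear forms on `H`. -/
def act (α : H k →ₗ[k] k) (b : HCK k →ₗ[k] k) : HCK k →ₗ[k] k :=
  LinearMap.mul' k k ∘ₗ TensorProduct.map α b ∘ₗ (coaction δ).toLinearMap

theorem actL_eq_act (α : H k →ₗ[k] k) (b : HCK k →ₗ[k] k) : actL α b = act (coproduct k) α b :=
  rfl

theorem comm_comp_Psi :
    (Algebra.TensorProduct.comm k (HCK k) (H k)).toAlgHom.comp (Psi k) =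
      coaction ((Algebra.TensorProduct.comm k (H k) (H k)).toAlgHom.comp (coproduct k)) := by
  refine MvPolynomial.algHom_ext fun t => ?_
  rw [AlgHom.comp_apply, Psi, coaction, MvPolynomial.aeval_X, MvPolynomial.aeval_X]
  exact (LinearMap.lTensor_comm ..).symm

theorem actR_eq_act (b : HCK k →ₗ[k] k) (α : H k →ₗ[k] k) :
    actR b α =
      act ((Algebra.TensorProduct.comm k (H k) (H k)).toAlgHom.comp (coproduct k)) α b := by
  have hmul : LinearMap.mul' k k ∘ₗ TensorProduct.map b α =
      LinearMap.mul' k k ∘ₗ TensorProduct.map α b ∘ₗ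
        (TensorProduct.comm k (HCK k) (H k)).toLinearMap :=
    TensorProduct.ext' fun _ _ => mul_comm _ _
  rw [act, ← comm_comp_Psi]
  exact congrArg (· ∘ₗ (Psi k).toLinearMap) hmul

theorem coaction_X (t : RTree) :
    coaction δ (MvPolynomial.X t) = (incl k).lTensor (H k) (δ (t.toH k)) :=
  MvPolynomial.aeval_X _ t

theorem map_id_augmentation_coaction (p : HCK k) :
    Algebra.TensorProduct.map (AlgHom.id k (H k)) (augmentation k RTree) (coaction δ p) =
      algebraMap k _ (augmentation k RTree p) := by
  refine DFunLike.congr_fun (MvPolynomial.algHom_ext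
    (f := (Algebra.TensorProduct.map (AlgHom.id k (H k)) (augmentation k RTree)).comp (coaction δ))
    (g := (Algebra.ofId k _).comp (augmentation k RTree)) fun t => ?_) p
  have hincl : (augmentation k RTree).toLinearMap ∘ₗ incl k = 0 :=
    LinearMap.ext (augmentation_incl k)
  rw [AlgHom.comp_apply, AlgHom.comp_apply, coaction_X, augmentation_X, map_zero]
  exact (LinearMap.lTensor_comp_apply ..).symm.trans (by rw [hincl, LinearMap.lTensor_zero]; rfl)

variable {δ}

theorem map_augmentation_id_coaction (hδ : IsCounital δ) (p : HCK k) :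
    Algebra.TensorProduct.map (augmentation k _) (AlgHom.id k (HCK k)) (coaction δ p) =
      1 ⊗ₜ p := by
  refine DFunLike.congr_fun (MvPolynomial.algHom_ext
    (f := (Algebra.TensorProduct.map (augmentation k _) (AlgHom.id k (HCK k))).comp (coaction δ))
    (g := Algebra.TensorProduct.includeRight) fun t => ?_) p
  have hcomm : (augmentation k _).toLinearMap.rTensor (HCK k) ∘ₗ (incl k).lTensor (H k) =
      (incl k).lTensor k ∘ₗ (augmentation k _).toLinearMap.rTensor (H k) :=
    (LinearMap.rTensor_comp_lTensor ..).trans (LinearMap.lTensor_comp_rTensor ..).symm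
  have hleft : (augmentation k _).toLinearMap.rTensor (H k) (δ (t.toH k)) = 1 ⊗ₜ t.toH k :=
    hδ.map_augmentation_id _
  rw [AlgHom.comp_apply, coaction_X]
  refine (DFunLike.congr_fun hcomm _).trans ?_
  rw [LinearMap.comp_apply, hleft, LinearMap.lTensor_tmul, incl_toH]
  rfl

variable (δ) in
theorem act_eq_comp_lTensor (α : H k →ₗ[k] k) (b : HCK k →ₗ[k] k) :
    act δ α b = (LinearMap.mul' k k ∘ₗ α.rTensor k) ∘ₗ b.lTensor (H k) ∘ₗ
      (coaction δ).toLinearMap := by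
  rw [act, ← LinearMap.rTensor_comp_lTensor]
  rfl

variable (δ) in
theorem act_eq_comp_rTensor (α : H k →ₗ[k] k) (b : HCK k →ₗ[k] k) :
    act δ α b = (LinearMap.mul' k k ∘ₗ b.lTensor k) ∘ₗ α.rTensor (HCK k) ∘ₗ
      (coaction δ).toLinearMap := by
  rw [act, ← LinearMap.lTensor_comp_rTensor]
  rfl

theorem act_counitCK (α : H k →ₗ[k] k) : act δ α (counitCK k) = α 1 • counitCK k := by
  rw [act_eq_comp_lTensor, counitCK_eq_augmentation]
  refine LinearMap.ext fun p => ?_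
  refine (congrArg (LinearMap.mul' k k ∘ₗ α.rTensor k) (map_id_augmentation_coaction δ p)).trans ?_
  rw [Algebra.algebraMap_eq_smul_one]
  simp [Algebra.TensorProduct.one_def, mul_comm]

theorem act_ZDot (hδ : IsCounital δ) (b : HCK k →ₗ[k] k) : act δ (ZDot k) b = b := by
  rw [act_eq_comp_rTensor, ZDot_eq_augmentation]
  refine LinearMap.ext fun p => ?_
  refine (congrArg (LinearMap.mul' k k ∘ₗ b.lTensor k) (map_augmentation_id_coaction hδ p)).trans ?_
  exact one_mul (b p)

theorem isInfinitesimal_deltaDot : IsInfinitesimal (deltaDot k) :=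
  isInfinitesimal_of_degree_ne_one fun m hm a => by
    rw [deltaDot, delta, MvPolynomial.lcoeff_apply, MvPolynomial.coeff_monomial, if_neg]
    rintro rfl
    exact hm (Finsupp.degree_single _ _)

theorem onTrees_monomial (α : H k →ₗ[k] k) (m : RTree →₀ ℕ) :
    onTrees α (MvPolynomial.monomial m 1) =
      ∑ t ∈ m.support, if m = Finsupp.single t 1 then α (t.toH k) else 0 :=
  (MvPolynomial.basisMonomials RTree k).constr_basis k _ m

theorem onTrees_X (α : H k →ₗ[k] k) (t : RTree) :
    onTrees α (MvPolynomial.X t) = α (t.toH k) := by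
  rw [MvPolynomial.X, onTrees_monomial, Finsupp.support_single t one_ne_zero, Finset.sum_singleton,
    if_pos rfl]

theorem isInfinitesimal_onTrees (α : H k →ₗ[k] k) : IsInfinitesimal (onTrees α) :=
  isInfinitesimal_of_degree_ne_one fun m hm a => by
    have hne : ∀ t ∈ m.support, m ≠ Finsupp.single t 1 := by
      rintro t - rfl
      exact hm (Finsupp.degree_single _ _)
    rw [← mul_one a, ← smul_eq_mul, ← MvPolynomial.smul_monomial, map_smul, onTrees_monomial,
      Finset.sum_eq_zero fun t ht => if_neg (hne t ht), smul_zero]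

theorem act_deltaDot (hδ : IsCounital δ) (α : H k →ₗ[k] k) : act δ α (deltaDot k) = onTrees α := by
  rw [act_eq_comp_lTensor]
  refine ((isInfinitesimal_deltaDot.lTensor_comp (map_id_augmentation_coaction δ)).comp _).ext
    (isInfinitesimal_onTrees α) fun t => ?_
  have hincl : deltaDot k ∘ₗ incl k = (augmentation k _).toLinearMap := by
    rw [← ZDot_eq_augmentation]
    exact LinearMap.ext (deltaDot_incl k)
  have hcoaction : (deltaDot k).lTensor (H k) (coaction δ (MvPolynomial.X t)) = t.toH k ⊗ₜ 1 := by
    rw [coaction_X, ← LinearMap.lTensor_comp_apply, hincl]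
    exact hδ.map_id_augmentation _
  rw [onTrees_X]
  exact (congrArg (LinearMap.mul' k k ∘ₗ α.rTensor k) hcoaction).trans (mul_one _)

end Coaction

/-! ### The Connes–Kreimer convolution algebra -/

section ConnesKreimer

open WithConv

variable {k : Type*} [Field k]

theorem coproductCK_coassoc :
    (Algebra.TensorProduct.assoc k k k (HCK k) (HCK k) (HCK k)).toAlgHom.comp
      ((Algebra.TensorProduct.map (coproductCK k) (AlgHom.id k _)).comp (coproductCK k)) =
    (Algebra.TensorProduct.map (AlgHom.id k _) (coproductCK k)).comp (coproductCK k) := by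
  refine MvPolynomial.algHom_ext fun t => ?_
  simp only [AlgHom.comp_apply, ← toHCK_rep, coproductCK_toHCK, map_sum,
    Algebra.TensorProduct.map_tmul, TensorProduct.sum_tmul, TensorProduct.tmul_sum, AlgHom.id_apply]
  exact Forest.sum_crowns_restrict_eq_sum_crowns_contract t.rep
    fun A B C => A.toHCK k ⊗ₜ[k] (B.toHCK k ⊗ₜ[k] C.toHCK k)

/-- The Connes–Kreimer coalgebra. It is made an instance only locally, since a polynomial algebra
already has the coalgebra structure in which the monomials are group-like. -/
abbrev coalgebraHCK : Coalgebra k (HCK k) where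
  comul := (coproductCK k).toLinearMap
  counit := counitCK k
  coassoc := congrArg AlgHom.toLinearMap coproductCK_coassoc
  rTensor_counit_comp_comul := by
    rw [counitCK_eq_augmentation]
    exact LinearMap.ext (isCounital_coproductCK k).map_augmentation_id
  lTensor_counit_comp_comul := by
    rw [counitCK_eq_augmentation]
    exact LinearMap.ext (isCounital_coproductCK k).map_id_augmentation

attribute [local instance] coalgebraHCK

theorem toConv_conv (b c : HCK k →ₗ[k] k) : toConv (conv b c) = toConv b * toConv c :=
  rfl

theorem toConv_counitCK : toConv (counitCK k) = 1 :=
  rfl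

theorem isConvInverse_iff {b b' : HCK k →ₗ[k] k} :
    IsConvInverse b b' ↔ toConv b * toConv b' = 1 ∧ toConv b' * toConv b = 1 := by
  rw [IsConvInverse, ← toConv_counitCK, ← toConv_conv, ← toConv_conv, toConv_injective.eq_iff,
    toConv_injective.eq_iff]

theorem IsConvInverse.unique {b b' d : HCK k →ₗ[k] k} (hb' : IsConvInverse b b')
    (hd : IsConvInverse b d) : d = b' :=
  toConv_injective <|
    left_inv_eq_right_inv (isConvInverse_iff.1 hd).2 (isConvInverse_iff.1 hb').1

/-- The endomorphism `(φ ⊗ id) ∘ Φ` of the algebra `HCK`, whose transpose is `b ↦ φ ⋆ b`. -/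
def twistAlgHom (φ : H k →ₐ[k] k) : HCK k →ₐ[k] HCK k :=
  (Algebra.TensorProduct.lid k (HCK k)).toAlgHom.comp
    ((Algebra.TensorProduct.map φ (AlgHom.id k (HCK k))).comp (Phi k))

theorem actL_eq_comp_twistAlgHom (φ : H k →ₐ[k] k) (b : HCK k →ₗ[k] k) :
    actL φ.toLinearMap b = b ∘ₗ (twistAlgHom φ).toLinearMap := by
  have hlid : LinearMap.mul' k k ∘ₗ TensorProduct.map φ.toLinearMap b =
      b ∘ₗ (TensorProduct.lid k (HCK k)).toLinearMap ∘ₗ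
        TensorProduct.map φ.toLinearMap LinearMap.id :=
    TensorProduct.ext' fun x y => (map_smul b (φ x) y).symm
  exact congrArg (· ∘ₗ (Phi k).toLinearMap) hlid

theorem actL_counitCK (φ : H k →ₐ[k] k) : actL φ.toLinearMap (counitCK k) = counitCK k := by
  rw [actL_eq_act, act_counitCK, AlgHom.toLinearMap_apply, map_one, one_smul]

theorem twistAlgHom_toHCK (φ : H k →ₐ[k] k) (F : Forest) :
    twistAlgHom φ (F.toHCK k) = ∑ S ∈ F.edges.powerset,
      φ ((F.spanning S).toH k) • (F.contract S).toHCK k := by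
  rw [twistAlgHom, AlgHom.comp_apply, AlgHom.comp_apply, Phi_toHCK, map_sum, map_sum]
  rfl

theorem map_twistAlgHom_comp_coproductCK (φ : H k →ₐ[k] k) :
    (Algebra.TensorProduct.map (twistAlgHom φ) (twistAlgHom φ)).comp (coproductCK k) =
      (coproductCK k).comp (twistAlgHom φ) := by
  refine MvPolynomial.algHom_ext fun t => ?_
  have hφ := (isMultiplicative_toH k).comp (φ : H k →* k)
  rw [AlgHom.comp_apply, AlgHom.comp_apply, ← toHCK_rep, twistAlgHom_toHCK, coproductCK_toHCK]
  simp only [map_sum, map_smul, coproductCK_toHCK, Algebra.TensorProduct.map_tmul,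
    twistAlgHom_toHCK, Finset.smul_sum, TensorProduct.sum_tmul, TensorProduct.tmul_sum,
    TensorProduct.smul_tmul_smul]
  refine Eq.trans ?_ (Forest.sum_powerset_edges_sum_crowns hφ
    (fun F G => F.toHCK k ⊗ₜ[k] G.toHCK k) t.rep).symm
  exact Finset.sum_congr rfl fun V _ => Finset.sum_comm

/-- `twistAlgHom φ` as an endomorphism of the Connes–Kreimer coalgebra. -/
def twistCoalgHom (φ : H k →ₐ[k] k) : HCK k →ₗc[k] HCK k where
  toLinearMap := (twistAlgHom φ).toLinearMap
  counit_comp := (actL_eq_comp_twistAlgHom φ (counitCK k)).symm.trans (actL_counitCK φ)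
  map_comp_comul := congrArg AlgHom.toLinearMap (map_twistAlgHom_comp_coproductCK φ)

theorem actL_conv (φ : H k →ₐ[k] k) (b c : HCK k →ₗ[k] k) :
    actL φ.toLinearMap (conv b c) = conv (actL φ.toLinearMap b) (actL φ.toLinearMap c) := by
  rw [actL_eq_comp_twistAlgHom, actL_eq_comp_twistAlgHom, actL_eq_comp_twistAlgHom]
  exact LinearMap.convMul_comp_coalgHom_distrib (toConv b) (toConv c) (twistCoalgHom φ)

theorem IsConvInverse.actL {b b' : HCK k →ₗ[k] k} (h : IsConvInverse b b') (φ : H k →ₐ[k] k) :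
    IsConvInverse (actL φ.toLinearMap b) (actL φ.toLinearMap b') :=
  ⟨by rw [← actL_conv, h.1, actL_counitCK], by rw [← actL_conv, h.2, actL_counitCK]⟩

end ConnesKreimer

end TreeHopf

end

theorem mainTheorem3_general (k : Type*) [Field k]
    (φ : H k →ₐ[k] k) (α : H k →ₗ[k] k) (b c : HCK k →ₗ[k] k) :
    (actL α (counitCK k) = α 1 • counitCK k ∧ actR (counitCK k) α = α 1 • counitCK k) ∧
    (actL α (deltaDot k) = onTrees α ∧ actR (deltaDot k) α = onTrees α) ∧
    (actL (ZDot k) b = b ∧ actR b (ZDot k) = b) ∧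
    actL φ.toLinearMap (conv b c) = conv (actL φ.toLinearMap b) (actL φ.toLinearMap c) ∧
    (∀ b' : HCK k →ₗ[k] k, IsConvInverse b b' →
      ∀ d : HCK k →ₗ[k] k,
        IsConvInverse (actL φ.toLinearMap b) d ↔ d = actL φ.toLinearMap b') := by
  have hδ := isCounital_coproduct k
  simp only [actR_eq_act]
  refine ⟨⟨act_counitCK α, act_counitCK α⟩, ⟨act_deltaDot hδ α, act_deltaDot hδ.comm α⟩,
    ⟨act_ZDot hδ b, act_ZDot hδ.comm b⟩, actL_conv φ b c, fun b' hb d => ⟨(hb.actL φ).unique, ?_⟩⟩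
  rintro rfl
  exact hb.actL φ

theorem mainTheorem3 (k : Type*) [Field k] [CharZero k]
    (φ : H k →ₐ[k] k) (α : H k →ₗ[k] k) (b c : HCK k →ₗ[k] k) :
    (actL α (counitCK k) = α 1 • counitCK k ∧ actR (counitCK k) α = α 1 • counitCK k) ∧
    (actL α (deltaDot k) = onTrees α ∧ actR (deltaDot k) α = onTrees α) ∧
    (actL (ZDot k) b = b ∧ actR b (ZDot k) = b) ∧
    actL φ.toLinearMap (conv b c) = conv (actL φ.toLinearMap b) (actL φ.toLinearMap c) ∧
    (∀ b' : HCK k →ₗ[k] k, IsConvInverse b b' →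
      ∀ d : HCK k →ₗ[k] k,
        IsConvInverse (actL φ.toLinearMap b) d ↔ d = actL φ.toLinearMap b') :=
  mainTheorem3_general k φ α b c
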